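/- **Theorem 2.** There is a function $N:\mathbb N\times\mathbb N\to\mathbb N$ with the following property. Let $k$ be a field, $K$ an algebraically closed extension field of $k$, and $G$ a linear algebraic $k$-group, i.e. an affine algebraic variety over $K$ with a group structure, defined over $k$ together with its group operations. Assume that $k$ contains sufficiently many elements in the following sense: either $k$ is infinite, or for some $n,d$ the group $G$ is $k$-isomorphic to a closed $k$-subgroup of $\mathrm{GL}_n(K)$ which is cut out in $\mathrm{GL}_n(K)$ by polynomials of degree at most $d$ in the matrix entries, and $|k|\ge N(n,d)$. Then there are a finite-dimensional vector space $V$ over $k$ and a $k$-rational tensor $t\in V_K^*\otimes V_K^*\otimes V_K$, where $V_K=V\otimes_k K$, such that the stabilizer of $t$ in $\mathrm{GL}(V_K)$ is defined over $k$ and is $k$-isomorphic to $G$. (Here $\mathrm{GL}(V_K)$ carries the $k$-structure given by $V$; the $k$-rational tensors are the elements of the $k$-span of the tensors $\varphi\otimes\psi\otimes x$ with $\varphi,\psi\in V^*$ and $x\in V$.) Moreover, $V$ and $t$ can be chosen so that $V$ is the underlying vector space of a finite-dimensional simple (not necessarily associative) algebra $A$ over $k$, i.e. one with nonzero multiplication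 and without proper two-sided ideals, such that the automorphism group $\mathrm{Aut}(A\otimes_k K)\subseteq\mathrm{GL}(V_K)$ is defined over $k$ and $k$-isomorphic to $G$, and $t$ is the structure tensor of the multiplication of $A\otimes_k K$: if $t=\sum f\otimes l\otimes v$, then $xy=\sum f(x)\,l(y)\,v$ for all $x,y\in V_K$. -/

import Mathlib

open scoped TensorProduct

universe u v w

noncomputable section

namespace GordeevPopov

section Varieties

variable (k : Type u) (K : Type v) [Field k] [Field K] [Algebra k K]

/-- A structure of affine algebraic variety over `K`, endowed with a `k`-structure, on the set `X`
of its points. The datum is the `k`-algebra `k[X]` of those regular functions `X → K` which are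
defined over `k`; the `K`-algebra `K[X]` of all regular functions is the `K`-algebra that `k[X]`
generates. -/
structure AffineKVariety (X : Type w) where
  /-- the algebra `k[X]` -/
  kFun : Subalgebra k (X → K)
  /-- `k[X]` is a `k`-algebra of finite type -/
  fg : kFun.FG
  /-- the canonical map from `K ⊗ k[X]` onto `K[X]` is an isomorphism -/
  baseChange_injective : Function.Injective
    (Algebra.TensorProduct.productLeftAlgHom (Algebra.ofId K (X → K)) kFun.val)
  /-- the points of `X` are the `K`-algebra homomorphisms `K[X] → K` -/
  points : ∀ χ : Algebra.adjoin K (kFun : Set (X → K)) →ₐ[K] K,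
    ∃! x : X, ∀ f : Algebra.adjoin K (kFun : Set (X → K)), χ f = f.1 x

variable {k K}

/-- The algebra `k[X × Y]` of the product variety, generated by the pullbacks of `k[X]` and
`k[Y]`. -/
def prodFun {X Y : Type*} (A : Subalgebra k (X → K)) (B : Subalgebra k (Y → K)) :
    Subalgebra k (X × Y → K) :=
  Algebra.adjoin k ({h | ∃ f ∈ A, h = fun p => f p.1} ∪ {h | ∃ g ∈ B, h = fun p => g p.2})

variable (k K)

/-- A structure of linear algebraic `k`-group (with underlying affine variety over `K`) on an
abstract group `G`: an affine variety with a `k`-structure such that the multiplication and the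
inversion are morphisms defined over `k` and the identity element is a `k`-rational point. -/
structure LinearAlgebraicKGroup (G : Type w) [Group G] extends AffineKVariety k K G where
  mul_mem : ∀ f ∈ kFun, (fun p : G × G => f (p.1 * p.2)) ∈ prodFun kFun kFun
  inv_mem : ∀ f ∈ kFun, (fun x : G => f x⁻¹) ∈ kFun
  one_rational : ∀ f ∈ kFun, ∃ c : k, f 1 = algebraMap k K c

variable {k K}

/-- For a variety `X` with algebra `A = k[X]`, the subset `H` is closed in `X` and defined over
`k`: it is the set of common zeros in `X` of functions from `k[X]`, and its vanishing ideal in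
`K[X]` is spanned over `K` by the functions from `k[X]` which it contains. -/
def IsClosedDefinedOver {X : Type*} (A : Subalgebra k (X → K)) (H : Set X) : Prop :=
  (∀ x, (∀ f ∈ A, (∀ y ∈ H, f y = 0) → f x = 0) → x ∈ H) ∧
  ∀ f ∈ Algebra.adjoin K (A : Set (X → K)), (∀ y ∈ H, f y = 0) →
    f ∈ Submodule.span K {g : X → K | g ∈ A ∧ ∀ y ∈ H, g y = 0}

/-- The algebra `k[H]` of a closed `k`-subgroup `H` of a `k`-group `X` with algebra `A = k[X]`: the
restrictions to `H` of the functions from `k[X]`. -/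
def restrictFun {X : Type*} [Group X] (A : Subalgebra k (X → K)) (H : Subgroup X) :
    Subalgebra k (H → K) where
  carrier := {h | ∃ f ∈ A, h = fun x => f x.1}
  mul_mem' := by
    rintro _ _ ⟨f, hf, rfl⟩ ⟨g, hg, rfl⟩
    exact ⟨f * g, A.mul_mem hf hg, rfl⟩
  add_mem' := by
    rintro _ _ ⟨f, hf, rfl⟩ ⟨g, hg, rfl⟩
    exact ⟨f + g, A.add_mem hf hg, rfl⟩
  algebraMap_mem' := fun c => ⟨algebraMap k (X → K) c, A.algebraMap_mem c, rfl⟩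

/-- The `k`-groups `G` and `H`, with algebras `A = k[G]` and `B = k[H]`, are `k`-isomorphic: there
is an isomorphism of abstract groups which is an isomorphism of varieties defined over `k`. -/
def KIsomorphic {G H : Type*} [Group G] [Group H]
    (A : Subalgebra k (G → K)) (B : Subalgebra k (H → K)) : Prop :=
  ∃ φ : G ≃* H, ∀ f : H → K, f ∈ B ↔ (fun x => f (φ x)) ∈ A

end Varieties

section GeneralLinear

variable (k : Type u) (K : Type v) [Field k] [Field K] [Algebra k K]
variable (V : Type w) [AddCommGroup V] [Module k V]

/-- The group `GL(V_K)`, where `V_K` is `K ⊗ V`. -/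
abbrev GLK : Type _ := (K ⊗[k] V) ≃ₗ[K] (K ⊗[k] V)

variable {k V}

/-- The extension of a `k`-linear form on `V` to a `K`-linear form on `V_K`. -/
def extendForm (φ : Module.Dual k V) : Module.Dual K (K ⊗[k] V) :=
  ((Algebra.linearMap k K) ∘ₗ φ).liftBaseChange K

variable (k V)

/-- The matrix coefficients on `GL(V_K)` defined over `k`. -/
def matrixCoeffs : Set (GLK k K V → K) :=
  {h | ∃ (φ : Module.Dual k V) (x : V), h = fun g => extendForm K φ (g (1 ⊗ₜ[k] x))}

/-- The `k`-structure of `GL(V_K)` given by the `k`-structure `V` of `V_K`: the algebra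
`k[GL(V_K)]` is generated by the matrix coefficients and the inverse of the determinant. -/
def glFun : Subalgebra k (GLK k K V → K) :=
  Algebra.adjoin k (matrixCoeffs k K V ∪
    {fun g : GLK k K V => (LinearMap.det (g : (K ⊗[k] V) →ₗ[K] (K ⊗[k] V)))⁻¹})

/-- The functions on `GL(V_K)` which are polynomials of degree at most `d` with coefficients in
`K` in the entries of matrices. -/
def polyFun (d : ℕ) : Submodule K (GLK k K V → K) :=
  (Submodule.span K (insert 1 (matrixCoeffs k K V))) ^ d

end GeneralLinear

/-- The linear algebraic `k`-group `G` is `k`-isomorphic to a closed `k`-subgroup of `GL_n` which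
is cut out in `GL_n` by polynomials of degree at most `d` in the entries of matrices. -/
def HasRealization {k : Type u} {K : Type v} [Field k] [Field K] [Algebra k K]
    {G : Type w} [Group G] (𝒢 : LinearAlgebraicKGroup k K G) (n d : ℕ) : Prop :=
  ∃ H : Subgroup (GLK k K (Fin n → k)),
    IsClosedDefinedOver (glFun k K (Fin n → k)) (H : Set (GLK k K (Fin n → k))) ∧
    KIsomorphic 𝒢.kFun (restrictFun (glFun k K (Fin n → k)) H) ∧
    ∀ g, (∀ f ∈ polyFun k K (Fin n → k) d, (∀ h ∈ H, f h = 0) → f g = 0) → g ∈ H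

section Algebras

variable {F : Type u} [Field F] {W : Type w} [AddCommGroup W] [Module F W]

/-- The (nonassociative) algebra on the vector space `W` with multiplication `μ` is simple: the
multiplication is nonzero and there are no proper two-sided ideals. -/
def IsSimpleAlgebra (μ : W →ₗ[F] W →ₗ[F] W) : Prop :=
  μ ≠ 0 ∧ ∀ I : Submodule F W, (∀ x ∈ I, ∀ y, μ x y ∈ I ∧ μ y x ∈ I) → I = ⊥ ∨ I = ⊤

/-- The full automorphism group of the algebra on `W` with multiplication `μ`. -/
def autGroup (μ : W →ₗ[F] W →ₗ[F] W) : Subgroup (W ≃ₗ[F] W) where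
  carrier := {g | ∀ x y, g (μ x y) = μ (g x) (g y)}
  one_mem' := fun _ _ => rfl
  mul_mem' := by
    intro a b ha hb x y
    change a (b (μ x y)) = μ (a (b x)) (a (b y))
    rw [hb, ha]
  inv_mem' := by
    intro a ha x y
    change a.symm (μ x y) = μ (a.symm x) (a.symm y)
    rw [LinearEquiv.symm_apply_eq, ha, LinearEquiv.apply_symm_apply, LinearEquiv.apply_symm_apply]

variable (F W)

/-- The space of tensors of type `W* ⊗ W* ⊗ W`. -/
abbrev StructureTensor : Type _ := Module.Dual F W ⊗[F] (Module.Dual F W ⊗[F] W)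

/-- The natural representation of `GL(W)` in `W* ⊗ W* ⊗ W`. -/
def tensorRep : Representation F (W ≃ₗ[F] W) (StructureTensor F W) :=
  let ρ : Representation F (W ≃ₗ[F] W) W := LinearEquiv.automorphismGroup.toLinearMapMonoidHom
  ρ.dual.tprod (ρ.dual.tprod ρ)

/-- The multiplication `x y = ∑ f(x) l(y) w` which corresponds to the tensor `∑ f ⊗ l ⊗ w`. -/
def tensorMul : StructureTensor F W →ₗ[F] (W →ₗ[F] W →ₗ[F] W) :=
  dualTensorHom F W (W →ₗ[F] W) ∘ₗ (dualTensorHom F W W).lTensor (Module.Dual F W)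

variable {F W}

/-- The stabilizer in `GL(W)` of a tensor in `W* ⊗ W* ⊗ W`. -/
def tensorStabilizer (t : StructureTensor F W) : Subgroup (W ≃ₗ[F] W) where
  carrier := {g | tensorRep F W g t = t}
  one_mem' := by simp
  mul_mem' := by
    intro a b ha hb
    simp only [Set.mem_ofPred_eq] at ha hb ⊢
    rw [map_mul, Module.End.mul_apply, hb, ha]
  inv_mem' := by
    intro a ha
    simp only [Set.mem_ofPred_eq] at ha ⊢
    conv_lhs => rw [← ha]
    rw [← Module.End.mul_apply, ← map_mul]
    simp

end Algebras

section Rational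

variable {k : Type u} (K : Type v) [Field k] [Field K] [Algebra k K]
variable (V : Type w) [AddCommGroup V] [Module k V]

/-- The `k`-rational tensors in `V_K* ⊗ V_K* ⊗ V_K`: the `k`-linear combinations of the tensors
`φ ⊗ ψ ⊗ x` with linear forms `φ`, `ψ` and a vector `x` coming from `V`. -/
def rationalTensors : Submodule k (StructureTensor K (K ⊗[k] V)) :=
  Submodule.span k {τ | ∃ (φ ψ : Module.Dual k V) (x : V),
    τ = extendForm K φ ⊗ₜ[K] (extendForm K ψ ⊗ₜ[K] ((1 : K) ⊗ₜ[k] x))}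

end Rational

end GordeevPopov

end

open GordeevPopov

/-! Let `F` be a finite-dimensional space of functions over `k` which generates `k[G]`, contains `1`
and is bistable, so that `f(xy) = ∑ f_i(x) (τ_i f)(y)` for a basis `f_i` of `F` and operators `τ_i`
on `F`. Put `P = F * F`. The algebra contains `F`, `P`, the dual of `P`, a left unit, and a chain of
auxiliary vectors. Its products encode the multiplication `F × F → P`, the operators `τ_i`, the
constant function `1` and the pairing of `P` with its dual, whose values are multiples of the left
unit.

`G` acts by right translations on `F` and `P`, contragrediently on the dual of `P`, and trivially on
the rest. Right translations commute with left ones, fix constants and respect products of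
functions, so this is an action by automorphisms (`act_map_mul`).

Conversely (`exists_eq_act`), the auxiliary vectors are rigid: an automorphism `g` fixes each of
them. Hence `g` preserves the three blocks and commutes with the `τ_i`, that is, with left
translations. The form `a ↦ (g a)(1)` on `F` sends `1` to `1` and is compatible with products. If
`F` consists of polynomials of large enough degree in generators of `k[G]`, such a form is the
evaluation at a point `z` (`exists_forall_eq_eval`). Commutation with left translations then gives
`(g a)(x) = a(xz)`. The action on `P` follows from products, and that on its dual from the pairing.

Rationality: the comorphism from `k[GL]` to `k[G]` is onto, and its kernel commutes with extension
of scalars to `K`. So the image of `G`, which is the automorphism group, is defined over `k` and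
`k`-isomorphic to `G` (`isClosedDefinedOver_and_kIsomorphic`). Simplicity: suitable multiplications
turn any nonzero element into a nonzero multiple of the left unit (`isSimpleAlgebra_mul`). Finally,
tensors correspond equivariantly to multiplications, so the stabilizer of the structure tensor is
the automorphism group (`tensorStabilizer_eq_autGroup`). -/

namespace GordeevPopov

/-! ### Finite-dimensional bistable spaces of functions on a linear algebraic group. -/

section Functions

variable {k : Type u} {K : Type v} [Field k] [Field K] [Algebra k K]

/-- The span of the functions `(x, y) ↦ a x * b y` with `a ∈ A` and `b ∈ B`. -/
def externalProduct {X Y : Type*} (A : Submodule k (X → K)) (B : Submodule k (Y → K)) :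
    Submodule k (X × Y → K) :=
  Submodule.span k {h | ∃ a ∈ A, ∃ b ∈ B, h = fun p => a p.1 * b p.2}

theorem mul_mem_externalProduct {X Y : Type*} {A : Submodule k (X → K)} {B : Submodule k (Y → K)}
    {a : X → K} {b : Y → K} (ha : a ∈ A) (hb : b ∈ B) :
    (fun p : X × Y => a p.1 * b p.2) ∈ externalProduct A B :=
  Submodule.subset_span ⟨a, ha, b, hb, rfl⟩

theorem externalProduct_mono {X Y : Type*} {A A' : Submodule k (X → K)} {B B' : Submodule k (Y → K)}
    (hA : A ≤ A') (hB : B ≤ B') : externalProduct A B ≤ externalProduct A' B' := by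
  apply Submodule.span_mono
  rintro _ ⟨a, ha, b, hb, rfl⟩
  exact ⟨a, hA ha, b, hB hb, rfl⟩

theorem sum_mem_externalProduct {X Y ι : Type*} [Fintype ι] {A : Submodule k (X → K)}
    {B : Submodule k (Y → K)} {a : ι → X → K} {b : ι → Y → K} (ha : ∀ i, a i ∈ A)
    (hb : ∀ i, b i ∈ B) {F : X × Y → K} (hF : ∀ x y, F (x, y) = ∑ i, a i x * b i y) :
    F ∈ externalProduct A B := by
  have : F = ∑ i, fun p : X × Y => a i p.1 * b i p.2 := by
    ext ⟨x, y⟩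
    simp [hF, Finset.sum_apply]
  rw [this]
  exact Submodule.sum_mem _ fun i _ => mul_mem_externalProduct (ha i) (hb i)

theorem exists_coeff_of_mem_externalProduct {X Y ι : Type*} [Fintype ι] {A : Submodule k (X → K)}
    {B : Submodule k (Y → K)} {e : ι → X → K} (he : A ≤ Submodule.span k (Set.range e))
    {F : X × Y → K} (hF : F ∈ externalProduct A B) :
    ∃ h : ι → Y → K, (∀ i, h i ∈ B) ∧ ∀ x y, F (x, y) = ∑ i, e i x * h i y := by
  induction hF using Submodule.span_induction with
  | mem F hF =>
    obtain ⟨a, ha, b, hb, rfl⟩ := hF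
    obtain ⟨c, rfl⟩ := (Submodule.mem_span_range_iff_exists_fun k).1 (he ha)
    refine ⟨fun i => c i • b, fun i => B.smul_mem _ hb, fun x y => ?_⟩
    simp only [Finset.sum_apply, Pi.smul_apply, Finset.sum_mul]
    exact Finset.sum_congr rfl fun i _ => by simp [Algebra.smul_def]; ring
  | zero => exact ⟨fun _ => 0, fun _ => B.zero_mem, by simp⟩
  | add F F' _ _ h h' =>
    obtain ⟨g, hg, h⟩ := h
    obtain ⟨g', hg', h'⟩ := h'
    refine ⟨fun i => g i + g' i, fun i => B.add_mem (hg i) (hg' i), fun x y => ?_⟩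
    simp [h, h', mul_add, Finset.sum_add_distrib]
  | smul c F _ h =>
    obtain ⟨g, hg, h⟩ := h
    refine ⟨fun i => c • g i, fun i => B.smul_mem _ (hg i), fun x y => ?_⟩
    simp [h, Finset.smul_sum]

theorem mul_mem_externalProduct_mul {X Y : Type*} {A A' : Submodule k (X → K)}
    {B B' : Submodule k (Y → K)} {F F' : X × Y → K} (hF : F ∈ externalProduct A B)
    (hF' : F' ∈ externalProduct A' B') : F * F' ∈ externalProduct (A * A') (B * B') := by
  have h : F * F' ∈ externalProduct A B * externalProduct A' B' := Submodule.mul_mem_mul hF hF'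
  rw [externalProduct, externalProduct, Submodule.span_mul_span] at h
  refine Submodule.span_mono ?_ h
  rintro _ ⟨_, ⟨a, ha, b, hb, rfl⟩, _, ⟨a', ha', b', hb', rfl⟩, rfl⟩
  refine ⟨a * a', Submodule.mul_mem_mul ha ha', b * b', Submodule.mul_mem_mul hb hb', ?_⟩
  ext p
  simp [mul_mul_mul_comm]

/-- Sums of products `a(x) b(y)` are already closed under multiplication, because `A * A = A` and `B
* B = B`. -/
theorem prodFun_le_externalProduct {X Y : Type*} {A : Subalgebra k (X → K)}
    {B : Subalgebra k (Y → K)} {F : X × Y → K} (hF : F ∈ prodFun A B) :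
    F ∈ externalProduct (Subalgebra.toSubmodule A) (Subalgebra.toSubmodule B) := by
  induction hF using Algebra.adjoin_induction with
  | mem F hF =>
    rcases hF with ⟨f, hf, rfl⟩ | ⟨g, hg, rfl⟩
    · simpa using mul_mem_externalProduct (A := Subalgebra.toSubmodule A)
        (B := Subalgebra.toSubmodule B) (a := f) (b := 1) hf B.one_mem
    · simpa using mul_mem_externalProduct (A := Subalgebra.toSubmodule A)
        (B := Subalgebra.toSubmodule B) (a := 1) (b := g) A.one_mem hg
  | algebraMap c =>
    have := mul_mem_externalProduct (A := Subalgebra.toSubmodule A)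
        (B := Subalgebra.toSubmodule B) (a := algebraMap k _ c) (b := 1)
        (A.algebraMap_mem c) B.one_mem
    convert this using 1
    ext p
    simp
  | add F F' _ _ h h' => exact Submodule.add_mem _ h h'
  | mul F F' _ _ h h' =>
    have := mul_mem_externalProduct_mul h h'
    rwa [A.isIdempotentElem_toSubmodule.eq, B.isIdempotentElem_toSubmodule.eq] at this

/-- Functions defined over `k` which are linearly independent over `k` are linearly independent
over `K`. -/
theorem AffineKVariety.linearIndependent {X : Type w} (𝒳 : AffineKVariety k K X) {ι : Type*}
    {f : ι → X → K} (hf : ∀ i, f i ∈ 𝒳.kFun) (hli : LinearIndependent k f) :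
    LinearIndependent K f := by
  let f' : ι → 𝒳.kFun := fun i => ⟨f i, hf i⟩
  have hli' : LinearIndependent k f' :=
    LinearIndependent.of_comp 𝒳.kFun.val.toLinearMap hli
  have h1 : LinearIndependent K fun i => (1 : K) ⊗ₜ[k] f' i := by
    have h2 : LinearIndepOn k id (Set.range f') := hli'.linearIndepOn_id
    let b := Module.Basis.extend h2
    have h3 := (Algebra.TensorProduct.basis K b).linearIndependent
    have hinj : Function.Injective f' := hli'.injective
    let j : ι → (h2.extend (Set.subset_univ _)) :=
      fun i => ⟨f' i, h2.subset_extend _ (Set.mem_range_self i)⟩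
    have hj : Function.Injective j := fun a b h => hinj (congrArg Subtype.val h)
    convert h3.comp j hj using 1
    ext i
    simp [b, j]
  have h4 := h1.map' (Algebra.TensorProduct.productLeftAlgHom (Algebra.ofId K (X → K))
    𝒳.kFun.val).toLinearMap (LinearMap.ker_eq_bot.2 𝒳.baseChange_injective)
  have h5 : f = (Algebra.TensorProduct.productLeftAlgHom (Algebra.ofId K (X → K))
      𝒳.kFun.val).toLinearMap ∘ fun i => (1 : K) ⊗ₜ[k] f' i := by
    ext i x
    simp [f']
  rw [h5]
  exact h4

/-- A space `S` of functions on a group is bistable if `(x, y) ↦ f (x * y)` belongs to `S ⊗ S` for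
each `f ∈ S`. -/
def IsBistable {G : Type*} [Group G] (S : Submodule k (G → K)) : Prop :=
  ∀ f ∈ S, (fun p : G × G => f (p.1 * p.2)) ∈ externalProduct S S

theorem IsBistable.mul {G : Type*} [Group G] {S T : Submodule k (G → K)} (hS : IsBistable S)
    (hT : IsBistable T) : IsBistable (S * T) := by
  intro f hf
  induction hf using Submodule.mul_induction_on' with
  | mem_mul_mem a ha b hb => exact mul_mem_externalProduct_mul (hS a ha) (hT b hb)
  | add a _ b _ h h' => exact Submodule.add_mem _ h h'

theorem IsBistable.sup {G : Type*} [Group G] {S T : Submodule k (G → K)} (hS : IsBistable S)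
    (hT : IsBistable T) : IsBistable (S ⊔ T) := by
  intro f hf
  obtain ⟨a, ha, b, hb, rfl⟩ := Submodule.mem_sup.1 hf
  exact Submodule.add_mem _ (externalProduct_mono le_sup_left le_sup_left (hS a ha))
    (externalProduct_mono le_sup_right le_sup_right (hT b hb))

theorem isBistable_one {G : Type*} [Group G] : IsBistable (1 : Submodule k (G → K)) := by
  intro f hf
  obtain ⟨c, rfl⟩ := Submodule.mem_one.1 hf
  convert mul_mem_externalProduct (A := (1 : Submodule k (G → K)))
    (B := (1 : Submodule k (G → K))) (a := algebraMap k _ c) (b := 1)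
    (Submodule.mem_one.2 ⟨c, rfl⟩) (Submodule.mem_one.2 ⟨1, by simp⟩) using 1
  ext p
  simp

theorem IsBistable.pow {G : Type*} [Group G] {S : Submodule k (G → K)} (hS : IsBistable S)
    (n : ℕ) : IsBistable (S ^ n) := by
  induction n with
  | zero => simpa using isBistable_one
  | succ n ih => rw [pow_succ]; exact ih.mul hS


theorem exists_finsupp_of_mem_externalProduct {X Y I : Type*} {A : Submodule k (X → K)}
    {B : Submodule k (Y → K)} {e : I → Y → K} (he : B ≤ Submodule.span k (Set.range e))
    {F : X × Y → K} (hF : F ∈ externalProduct A B) :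
    ∃ c : I →₀ A, ∀ x y, F (x, y) = c.sum fun i a => a.1 x * e i y := by
  classical
  let L : (I →₀ A) →ₗ[k] (X × Y → K) := Finsupp.lsum k fun i =>
    { toFun := fun a p => a.1 p.1 * e i p.2
      map_add' := fun a b => by ext p; simp [add_mul]
      map_smul' := fun a b => by ext p; simp }
  have hL : externalProduct A B ≤ LinearMap.range L := by
    refine Submodule.span_le.2 ?_
    rintro _ ⟨a, ha, b, hb, rfl⟩
    have hb' := he hb
    clear hb
    simp only [SetLike.mem_coe]
    induction hb' using Submodule.span_induction with
    | mem b hb =>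
      obtain ⟨i, rfl⟩ := hb
      refine ⟨Finsupp.single i ⟨a, ha⟩, ?_⟩
      simp only [L, Finsupp.lsum_single]
      rfl
    | zero =>
      convert (LinearMap.range L).zero_mem using 1
      ext p
      simp
    | add b b' _ _ h h' =>
      convert (LinearMap.range L).add_mem h h' using 1
      ext p
      simp [mul_add]
    | smul c b _ h =>
      convert (LinearMap.range L).smul_mem c h using 1
      ext p
      simp
  obtain ⟨c, rfl⟩ := hL hF
  refine ⟨c, fun x y => ?_⟩
  simp [L, Finsupp.sum, Finset.sum_apply]

/-- Right translations act locally finitely on `k[G]`. -/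
theorem LinearAlgebraicKGroup.exists_rightStable {G : Type w} [Group G]
    (𝒢 : LinearAlgebraicKGroup k K G) {u : G → K} (hu : u ∈ 𝒢.kFun) :
    ∃ W : Submodule k (G → K), W.FG ∧ W ≤ Subalgebra.toSubmodule 𝒢.kFun ∧ u ∈ W ∧
      ∀ f ∈ W, (fun p : G × G => f (p.1 * p.2)) ∈
        externalProduct W (Subalgebra.toSubmodule 𝒢.kFun) := by
  classical
  obtain ⟨I, ⟨b⟩⟩ : ∃ I : Set 𝒢.kFun, Nonempty (Module.Basis I k 𝒢.kFun) :=
    ⟨_, ⟨Module.Basis.ofVectorSpace k 𝒢.kFun⟩⟩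
  let e : I → G → K := fun i => (b i).1
  have he : ∀ i, e i ∈ 𝒢.kFun := fun i => (b i).2
  have hli : LinearIndependent K e := 𝒢.linearIndependent he
    (b.linearIndependent.map' 𝒢.kFun.val.toLinearMap
      (LinearMap.ker_eq_bot.2 Subtype.val_injective))
  have hspan : Subalgebra.toSubmodule 𝒢.kFun ≤ Submodule.span k (Set.range e) := by
    intro f hf
    have h1 := b.mem_span ⟨f, hf⟩
    have h2 := Submodule.mem_map_of_mem (f := 𝒢.kFun.val.toLinearMap) h1
    rw [Submodule.map_span, ← Set.range_comp] at h2
    exact h2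
  have hcoord : ∀ f ∈ 𝒢.kFun, ∃ c : I →₀ Subalgebra.toSubmodule 𝒢.kFun,
      ∀ x y, f (x * y) = c.sum fun i a => a.1 x * e i y := by
    intro f hf
    obtain ⟨c, hc⟩ := exists_finsupp_of_mem_externalProduct hspan
      (prodFun_le_externalProduct (𝒢.mul_mem f hf))
    exact ⟨c, hc⟩
  choose c hc using hcoord
  let cu := c u hu
  -- One finite index set which serves for the expansion of `u` and for those of all the `e i`
  -- occurring in it.
  let J : Finset I := cu.support ∪ cu.support.biUnion fun i => (c (e i) (he i)).support
  have hJ : ∀ x y, u (x * y) = ∑ i ∈ J, (cu i).1 x * e i y := by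
    intro x y
    rw [hc u hu]
    exact Finsupp.sum_of_support_subset _ Finset.subset_union_left _ (by simp)
  have hJ' : ∀ i ∈ cu.support, ∀ x y, e i (x * y) = ∑ j ∈ J, (c (e i) (he i) j).1 x * e j y := by
    intro i hi x y
    rw [hc (e i) (he i)]
    refine Finsupp.sum_of_support_subset _ (fun j hj => ?_) _ (by simp)
    exact Finset.mem_union_right _ (Finset.mem_biUnion.2 ⟨i, hi, hj⟩)
  -- Associativity: compare the coefficients of `e j z` in `u((xy)z) = u(x(yz))`. They are values in
  -- `K`, so independence over `K` is needed.
  have key : ∀ j ∈ J, ∀ x y,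
      (cu j).1 (x * y) = ∑ i ∈ cu.support, (cu i).1 x * (c (e i) (he i) j).1 y := by
    intro j hj x y
    have h := linearIndependent_iff'.1 hli J (fun j => (cu j).1 (x * y) -
      ∑ i ∈ cu.support, (cu i).1 x * (c (e i) (he i) j).1 y) ?_ j hj
    · exact sub_eq_zero.1 h
    · ext z
      have h1 := hJ (x * y) z
      rw [mul_assoc, hc u hu x (y * z), Finsupp.sum] at h1
      rw [Finset.sum_congr rfl fun i hi => by rw [hJ' i hi y z]] at h1
      simp only [sub_smul, Finset.sum_sub_distrib, Pi.sub_apply, Finset.sum_apply, Pi.smul_apply,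
        smul_eq_mul, Pi.zero_apply, Finset.sum_mul]
      rw [← h1, sub_eq_zero, Finset.sum_comm]
      simp only [Finset.mul_sum, mul_assoc, cu]
  have hmem : ∀ i ∈ J, (cu i).1 ∈ Submodule.span k ((fun i => (cu i).1) '' J) :=
    fun i hi => Submodule.subset_span ⟨i, hi, rfl⟩
  refine ⟨Submodule.span k ((fun i => (cu i).1) '' J), ?_, ?_, ?_, ?_⟩
  · exact Submodule.fg_span (J.finite_toSet.image _)
  · rw [Submodule.span_le]
    rintro _ ⟨i, -, rfl⟩
    exact (cu i).2
  -- The values `e i 1` lie in `k` because the identity is a rational point; thus `u` is in the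
  -- `k`-span and not merely in the `K`-span.
  · have h1 : u = ∑ i ∈ J, e i 1 • (cu i).1 := by
      ext x
      simpa [Finset.sum_apply, mul_comm] using hJ x 1
    rw [h1]
    refine Submodule.sum_mem _ fun i hi => ?_
    obtain ⟨t, ht⟩ := 𝒢.one_rational (e i) (he i)
    rw [ht, algebraMap_smul]
    exact Submodule.smul_mem _ _ (hmem i hi)
  · intro f hf
    induction hf using Submodule.span_induction with
    | mem f hf =>
      obtain ⟨j, hj, rfl⟩ := hf
      have h1 : (fun p : G × G => (cu j).1 (p.1 * p.2)) =
          ∑ i ∈ cu.support, fun p => (cu i).1 p.1 * (c (e i) (he i) j).1 p.2 := by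
        ext ⟨x, y⟩
        simp only [key j hj x y, Finset.sum_apply]
      simp only [h1]
      exact Submodule.sum_mem _ fun i hi => mul_mem_externalProduct
        (hmem i (Finset.mem_union_left _ hi)) (c (e i) (he i) j).2
    | zero => exact Submodule.zero_mem _
    | add f g _ _ h h' => exact Submodule.add_mem _ h h'
    | smul t f _ h => exact Submodule.smul_mem _ t h

theorem AffineKVariety.exists_basis {X : Type w} (𝒳 : AffineKVariety k K X)
    {W : Submodule k (X → K)} (hfg : W.FG) (hW : W ≤ Subalgebra.toSubmodule 𝒳.kFun) :
    ∃ (n : ℕ) (e : Fin n → X → K), LinearIndependent K e ∧ Submodule.span k (Set.range e) = W := by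
  have : Module.Finite k W := Module.Finite.iff_fg.2 hfg
  let b := Module.finBasis k W
  refine ⟨_, fun i => (b i).1, 𝒳.linearIndependent (fun i => hW (b i).2)
    (b.linearIndependent.map' W.subtype W.ker_subtype), ?_⟩
  have h2 := congrArg (Submodule.map W.subtype) b.span_eq
  rw [Submodule.map_span, ← Set.range_comp] at h2
  rwa [Submodule.map_subtype_top] at h2

/-- Each function in `k[G]` belongs to a finite-dimensional bistable space. -/
theorem LinearAlgebraicKGroup.exists_isBistable {G : Type w} [Group G]
    (𝒢 : LinearAlgebraicKGroup k K G) {u : G → K} (hu : u ∈ 𝒢.kFun) :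
    ∃ S : Submodule k (G → K), S.FG ∧ S ≤ Subalgebra.toSubmodule 𝒢.kFun ∧ u ∈ S ∧
      IsBistable S := by
  obtain ⟨W, hfg, hW, huW, hstab⟩ := 𝒢.exists_rightStable hu
  obtain ⟨n, e, hli, hspan⟩ := 𝒢.exists_basis hfg hW
  have he : ∀ i, e i ∈ W := fun i => hspan ▸ Submodule.subset_span (Set.mem_range_self i)
  have hcoeff := fun j => exists_coeff_of_mem_externalProduct hspan.ge (hstab (e j) (he j))
  choose h hmem hmul' using hcoeff
  have hmul : ∀ j x y, e j (x * y) = ∑ i, e i x * h j i y := hmul'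
  -- The matrix coefficients of right translation on `W` multiply like matrices; hence their span is
  -- bistable on both sides, which `W` need not be.
  have hh : ∀ j l x y, h j l (x * y) = ∑ i, h i l x * h j i y := by
    intro j l x y
    have := Fintype.linearIndependent_iff.1 hli
      (fun l => h j l (x * y) - ∑ i, h i l x * h j i y) ?_ l
    · exact sub_eq_zero.1 this
    · ext z
      have h1 := hmul j (z * x) y
      have h2 := hmul j z (x * y)
      rw [← mul_assoc, h1] at h2
      rw [Finset.sum_congr rfl fun i _ => by rw [hmul i z x]] at h2
      simp only [sub_smul, Finset.sum_sub_distrib, Pi.sub_apply, Finset.sum_apply, Pi.smul_apply,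
        smul_eq_mul, Pi.zero_apply, Finset.sum_mul] at h2 ⊢
      rw [sub_eq_zero, Finset.sum_congr rfl fun i _ => mul_comm (h j i (x * y)) (e i z), ← h2,
        Finset.sum_comm]
      exact Finset.sum_congr rfl fun i _ => Finset.sum_congr rfl fun j _ => by ring
  refine ⟨Submodule.span k (Set.range fun p : Fin n × Fin n => h p.1 p.2),
    Submodule.fg_span (Set.finite_range _), ?_, ?_, ?_⟩
  · rw [Submodule.span_le]
    rintro _ ⟨p, rfl⟩
    exact hmem p.1 p.2
  · have hle : W ≤ Submodule.span k (Set.range fun p : Fin n × Fin n => h p.1 p.2) := by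
      rw [← hspan, Submodule.span_le]
      rintro _ ⟨j, rfl⟩
      have h1 : e j = ∑ i, e i 1 • h j i := by
        ext x
        simpa [Finset.sum_apply] using hmul j 1 x
      rw [h1]
      refine Submodule.sum_mem _ fun i hi => ?_
      obtain ⟨t, ht⟩ := 𝒢.one_rational (e i) (hW (he i))
      rw [ht, algebraMap_smul]
      exact Submodule.smul_mem _ _ (Submodule.subset_span ⟨(j, i), rfl⟩)
    exact hle huW
  · intro f hf
    induction hf using Submodule.span_induction with
    | mem f hf =>
      obtain ⟨⟨j, l⟩, rfl⟩ := hf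
      exact sum_mem_externalProduct (a := fun i => h i l) (b := fun i => h j i)
        (fun i => Submodule.subset_span (Set.mem_range_self (i, l)))
        (fun i => Submodule.subset_span (Set.mem_range_self (j, i))) (hh j l)
    | zero => exact Submodule.zero_mem _
    | add f g _ _ h h' => exact Submodule.add_mem _ h h'
    | smul t f _ h => exact Submodule.smul_mem _ t h

/-- `k[G]` is generated by a finite-dimensional bistable space which contains the constants. -/
theorem LinearAlgebraicKGroup.exists_generating_isBistable {G : Type w} [Group G]
    (𝒢 : LinearAlgebraicKGroup k K G) :
    ∃ S : Submodule k (G → K), S.FG ∧ 1 ≤ S ∧ IsBistable S ∧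
      Algebra.adjoin k (S : Set (G → K)) = 𝒢.kFun := by
  classical
  obtain ⟨s, hs⟩ := 𝒢.fg
  have h : ∀ t : Finset (G → K), (t : Set (G → K)) ⊆ 𝒢.kFun → ∃ S : Submodule k (G → K), S.FG ∧
      1 ≤ S ∧ IsBistable S ∧ S ≤ Subalgebra.toSubmodule 𝒢.kFun ∧ (t : Set (G → K)) ⊆ S := by
    intro t
    induction t using Finset.induction_on with
    | empty =>
      intro _
      refine ⟨1, ?_, le_rfl, isBistable_one, ?_, by simp⟩
      · rw [Submodule.one_eq_span]; exact Submodule.fg_span (Set.finite_singleton _)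
      · rw [Submodule.one_eq_span, Submodule.span_le]; simp
    | insert u t _ ih =>
      intro ht
      rw [Finset.coe_insert, Set.insert_subset_iff] at ht
      obtain ⟨S, h1, h2, h3, h4, h5⟩ := ih ht.2
      obtain ⟨S', h1', h2', h3', h4'⟩ := 𝒢.exists_isBistable ht.1
      refine ⟨S ⊔ S', h1.sup h1', h2.trans le_sup_left, h3.sup h4', sup_le h4 h2', ?_⟩
      rw [Finset.coe_insert, Set.insert_subset_iff]
      exact ⟨le_sup_right (a := S) h3', h5.trans (le_sup_left (b := S'))⟩
  obtain ⟨S, h1, h2, h3, h4, h5⟩ := h s (by rw [← hs]; exact Algebra.subset_adjoin)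
  refine ⟨S, h1, h2, h3, le_antisymm (Algebra.adjoin_le h4) ?_⟩
  rw [← hs]
  exact Algebra.adjoin_mono h5

end Functions

/-! ### Points as multiplicative linear forms on a finite-dimensional space of functions. -/

section Points

variable {k : Type u} {K : Type v} [Field k] [Field K] [Algebra k K]

theorem span_pow_le_span_pow {X : Type*} (S : Submodule k (X → K)) (n : ℕ) :
    Submodule.span K (S : Set (X → K)) ^ n ≤
      Submodule.span K ((S ^ n : Submodule k (X → K)) : Set (X → K)) := by
  rw [Submodule.span_pow]
  exact Submodule.span_mono (Submodule.pow_subset_pow _)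

/-- A linear form which is multiplicative on the polynomials of a sufficiently large degree in the
generators of `k[X]` is the evaluation at a point. -/
theorem AffineKVariety.exists_forall_eq_eval {X : Type w} (𝒳 : AffineKVariety k K X)
    {S : Submodule k (X → K)} (hfg : S.FG) (h1 : 1 ≤ S)
    (hS : Algebra.adjoin k (S : Set (X → K)) = 𝒳.kFun) :
    ∃ D : ℕ, 0 < D ∧ ∀ Λ : (X → K) →ₗ[K] K, Λ 1 = 1 →
      (∀ a ∈ Submodule.span K ((S ^ D : Submodule k (X → K)) : Set (X → K)),
        ∀ b ∈ Submodule.span K ((S ^ D : Submodule k (X → K)) : Set (X → K)),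
        a * b ∈ Submodule.span K ((S ^ D : Submodule k (X → K)) : Set (X → K)) →
        Λ (a * b) = Λ a * Λ b) →
      ∃ x : X, ∀ f ∈ S ^ D, Λ f = f x := by
  classical
  have hSk : S ≤ Subalgebra.toSubmodule 𝒳.kFun := by
    rw [← hS]; exact Algebra.subset_adjoin
  obtain ⟨n, σ, -, hσ⟩ := 𝒳.exists_basis hfg hSk
  have hσS : ∀ i, σ i ∈ S := fun i => hσ ▸ Submodule.subset_span (Set.mem_range_self i)
  set T : Submodule K (X → K) := Submodule.span K (S : Set (X → K)) with hT
  have hT1 : 1 ≤ T := by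
    rw [Submodule.one_eq_span, Submodule.span_le, Set.singleton_subset_iff]
    exact Submodule.subset_span (h1 (Submodule.one_le.1 le_rfl))
  have hTσ : T = Submodule.span K (Set.range σ) := by
    apply le_antisymm
    · rw [hT, Submodule.span_le, ← hσ]
      exact Submodule.span_le_restrictScalars k K (Set.range σ)
    · rw [Submodule.span_le]
      rintro _ ⟨i, rfl⟩
      exact Submodule.subset_span (hσS i)
  let φ : MvPolynomial (Fin n) K →ₐ[K] (X → K) := MvPolynomial.aeval σ
  have hφ : φ.range = Algebra.adjoin K (𝒳.kFun : Set (X → K)) := by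
    rw [← Algebra.adjoin_range_eq_range_aeval]
    apply le_antisymm
    · apply Algebra.adjoin_mono
      rintro _ ⟨i, rfl⟩
      exact hSk (hσS i)
    · rw [← hS]
      refine Algebra.adjoin_le fun f hf => ?_
      have : f ∈ (Algebra.adjoin K (Set.range σ)).restrictScalars k := by
        refine Algebra.adjoin_le (fun s hs => ?_) hf
        have : s ∈ T := Submodule.subset_span hs
        rw [hTσ] at this
        exact Algebra.span_le_adjoin K _ this
      exact this
  obtain ⟨s, hs⟩ := (inferInstance : IsNoetherianRing (MvPolynomial (Fin n) K)).noetherian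
    (RingHom.ker φ)
  -- The relations between the generators `σ` form a finitely generated ideal; `D` bounds the
  -- degrees of its generators, and the added 1 makes it positive.
  let D := s.sup MvPolynomial.totalDegree + 1
  refine ⟨D, Nat.succ_pos _, fun Λ hΛ1 hΛ => ?_⟩
  have hmono : ∀ {i j : ℕ}, i ≤ j → T ^ i ≤ T ^ j := fun h => pow_le_pow_right' hT1 h
  have hTD : T ^ D ≤ Submodule.span K ((S ^ D : Submodule k (X → K)) : Set (X → K)) :=
    span_pow_le_span_pow S D
  -- Multiplicativity of `Λ` is available only while products stay in degree at most `D`;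
  -- multiplying by one generator at a time suffices below.
  have hΛT : ∀ j, j + 1 ≤ D → ∀ a ∈ T ^ j, ∀ b ∈ T, Λ (a * b) = Λ a * Λ b := by
    intro j hj a ha b hb
    refine hΛ a (hTD (hmono (by omega) ha)) b (hTD (hmono (by omega : 1 ≤ D) (by simpa))) ?_
    refine hTD (hmono hj ?_)
    rw [pow_succ]
    exact Submodule.mul_mem_mul ha hb
  let l : Fin n → K := fun i => Λ (σ i)
  have hmon : ∀ (α : Fin n →₀ ℕ) (c : K) (j : ℕ), (MvPolynomial.monomial α c).totalDegree ≤ j →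
      j ≤ D → φ (MvPolynomial.monomial α c) ∈ T ^ j ∧
        Λ (φ (MvPolynomial.monomial α c)) = MvPolynomial.eval l (MvPolynomial.monomial α c) := by
    intro α c
    refine MvPolynomial.induction_on_monomial (motive := fun P => ∀ j : ℕ, P.totalDegree ≤ j →
      j ≤ D → φ P ∈ T ^ j ∧ Λ (φ P) = MvPolynomial.eval l P) ?_ ?_ α c
    · intro a j _ _
      have h : φ (MvPolynomial.C a) = a • 1 := by
        rw [MvPolynomial.algHom_C, Algebra.algebraMap_eq_smul_one]
      rw [h]
      refine ⟨Submodule.smul_mem _ _ (hmono (Nat.zero_le j) ?_), by simp [hΛ1]⟩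
      rw [pow_zero]
      exact Submodule.one_le.1 le_rfl
    · intro p i ih j hj hjD
      by_cases hp : p = 0
      · simp [hp]
      · rw [MvPolynomial.totalDegree_mul_of_isDomain hp (MvPolynomial.X_ne_zero i),
          MvPolynomial.totalDegree_X] at hj
        obtain ⟨j, rfl⟩ : ∃ j', j = j' + 1 := ⟨j - 1, by omega⟩
        obtain ⟨h2, h3⟩ := ih j (by omega) (by omega)
        have hX : φ (MvPolynomial.X i) = σ i := MvPolynomial.aeval_X _ _
        have hσT : σ i ∈ T := Submodule.subset_span (hσS i)
        rw [map_mul, hX, hΛT j hjD _ h2 _ hσT, h3, pow_succ]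
        exact ⟨Submodule.mul_mem_mul h2 hσT, by simp [l]⟩
  have hpoly : ∀ P : MvPolynomial (Fin n) K, P.totalDegree ≤ D → Λ (φ P) = MvPolynomial.eval l P := by
    intro P hP
    conv_lhs => rw [P.as_sum]
    conv_rhs => rw [P.as_sum]
    rw [map_sum, map_sum, map_sum]
    refine Finset.sum_congr rfl fun α hα => (hmon α _ D ?_ le_rfl).2
    rw [MvPolynomial.totalDegree_monomial _ (MvPolynomial.mem_support_iff.1 hα)]
    exact (MvPolynomial.le_totalDegree hα).trans hP
  -- The generating relations have degree at most `D`, where `Λ` is substitution of `l`. So `l`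
  -- satisfies them, hence all relations, and defines a homomorphism on `K[X]`.
  have hker : RingHom.ker φ ≤ RingHom.ker (MvPolynomial.aeval l : MvPolynomial (Fin n) K →ₐ[K] K) := by
    rw [← hs]
    refine Ideal.span_le.2 fun P hP => ?_
    have hP0 : φ P = 0 := by
      have : P ∈ RingHom.ker φ := hs ▸ Ideal.subset_span hP
      exact this
    have h2 := hpoly P ((Finset.le_sup (f := MvPolynomial.totalDegree) hP).trans (Nat.le_succ _))
    rw [hP0, map_zero] at h2
    simp only [SetLike.mem_coe, RingHom.mem_ker]
    rw [MvPolynomial.aeval_def, MvPolynomial.eval₂_eq_eval_map]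
    simpa using h2.symm
  let φ' : MvPolynomial (Fin n) K →ₐ[K] Algebra.adjoin K (𝒳.kFun : Set (X → K)) :=
    φ.codRestrict _ fun P => by rw [← hφ]; exact ⟨P, rfl⟩
  have hφ' : Function.Surjective φ' := by
    rintro ⟨f, hf⟩
    rw [← hφ] at hf
    obtain ⟨P, rfl⟩ := hf
    exact ⟨P, rfl⟩
  have hker' : RingHom.ker φ'.toRingHom ≤
      RingHom.ker (MvPolynomial.aeval l : MvPolynomial (Fin n) K →ₐ[K] K).toRingHom := by
    intro P hP
    refine hker ?_
    have h2 : φ' P = 0 := hP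
    exact congrArg Subtype.val h2
  obtain ⟨x, hx, -⟩ := 𝒳.points (φ'.liftOfSurjective hφ' (MvPolynomial.aeval l) hker')
  have hσx : ∀ i, Λ (σ i) = σ i x := by
    intro i
    have h2 := hx (φ' (MvPolynomial.X i))
    rw [AlgHom.liftOfSurjective_apply] at h2
    simpa [φ', φ, l] using h2
  have hTx : ∀ a ∈ T, Λ a = a x := by
    intro a ha
    rw [hTσ] at ha
    induction ha using Submodule.span_induction with
    | mem a ha => obtain ⟨i, rfl⟩ := ha; exact hσx i
    | zero => simp
    | add a b _ _ h h' => simp [h, h']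
    | smul c a _ h => simp [h]
  have hTjx : ∀ j ≤ D, ∀ a ∈ T ^ j, Λ a = a x := by
    intro j
    induction j with
    | zero =>
      intro _ a ha
      rw [pow_zero] at ha
      obtain ⟨c, rfl⟩ := Submodule.mem_one.1 ha
      rw [Algebra.algebraMap_eq_smul_one, map_smul, hΛ1]
      simp
    | succ j ih =>
      intro hj a ha
      rw [pow_succ] at ha
      induction ha using Submodule.mul_induction_on' with
      | mem_mul_mem a ha b hb =>
        rw [hΛT j hj a ha b hb, ih (by omega) a ha, hTx b hb, Pi.mul_apply]
      | add a _ b _ h h' => rw [map_add, h, h', Pi.add_apply]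
  refine ⟨x, fun f hf => hTjx D le_rfl f ?_⟩
  have : ∀ j, ∀ f ∈ S ^ j, f ∈ T ^ j := by
    intro j
    induction j with
    | zero =>
      intro f hf
      rw [pow_zero] at hf ⊢
      obtain ⟨c, rfl⟩ := Submodule.mem_one.1 hf
      exact Submodule.mem_one.2 ⟨algebraMap k K c, by ext; simp⟩
    | succ j ih =>
      intro f hf
      rw [pow_succ] at hf ⊢
      induction hf using Submodule.mul_induction_on' with
      | mem_mul_mem a ha b hb => exact Submodule.mul_mem_mul (ih a ha) (Submodule.subset_span hb)
      | add a _ b _ h h' => exact Submodule.add_mem _ h h'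
  exact this D f hf

theorem exists_linearMap_of_linearIndependent {E ι : Type*} [AddCommGroup E] [Module K E]
    {e : ι → E} (he : LinearIndependent K e) (c : ι → K) : ∃ Λ : E →ₗ[K] K, ∀ i, Λ (e i) = c i := by
  obtain ⟨Λ, hΛ⟩ := LinearMap.exists_extend ((Module.Basis.span he).constr K c)
  refine ⟨Λ, fun i => ?_⟩
  have h := LinearMap.congr_fun hΛ (Module.Basis.span he i)
  rw [Module.Basis.constr_basis] at h
  rw [← h, LinearMap.comp_apply, Submodule.subtype_apply, Module.Basis.span_apply]

/-- A basis `f` of a finite-dimensional generating space `F` of `k[G]`, and a basis `p` of the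
space spanned by the products of two elements of `F`, with the structure constants of the group and
of its algebra of functions. The values of `f` at the points of `G` are characterized by the
multiplication `F × F → F * F`. -/
structure FunctionModel {G : Type w} [Group G] (𝒢 : LinearAlgebraicKGroup k K G) where
  m : ℕ
  q : ℕ
  f : Fin m → G → K
  p : Fin q → G → K
  h : Fin m → Fin m → G → K
  Q : Fin q → Fin q → G → K
  τ : Fin m → Fin m → Fin m → k
  o : Fin m → k
  c : Fin m → Fin m → Fin q → k
  f_mem : ∀ i, f i ∈ 𝒢.kFun
  h_mem : ∀ i j, h i j ∈ 𝒢.kFun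
  Q_mem : ∀ i j, Q i j ∈ 𝒢.kFun
  f_indep : LinearIndependent K f
  p_indep : LinearIndependent K p
  f_mul : ∀ j x y, f j (x * y) = ∑ i, f i x * h i j y
  p_mul : ∀ j x y, p j (x * y) = ∑ i, p i x * Q i j y
  h_eq : ∀ i j x, h i j x = ∑ l, algebraMap k K (τ i j l) * f l x
  one_eq : ∀ x, ∑ i, algebraMap k K (o i) * f i x = 1
  mul_eq : ∀ i j x, f i x * f j x = ∑ s, algebraMap k K (c i j s) * p s x
  p_span : ∀ s, p s ∈ Submodule.span K (Set.range fun ij : Fin m × Fin m => f ij.1 * f ij.2)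
  generate : Algebra.adjoin k (Set.range f) = 𝒢.kFun
  exists_point : ∀ (l : Fin m → K) (l' : Fin q → K), ∑ i, algebraMap k K (o i) * l i = 1 →
    (∀ i j, l i * l j = ∑ s, algebraMap k K (c i j s) * l' s) → ∃ z : G, ∀ i, l i = f i z

/-- `F = S ^ D` works: powers of bistable spaces are bistable, and the degree `D` is the one which
makes multiplicative forms evaluations. -/
theorem LinearAlgebraicKGroup.nonempty_functionModel {G : Type w} [Group G]
    (𝒢 : LinearAlgebraicKGroup k K G) : Nonempty (FunctionModel 𝒢) := by
  classical
  obtain ⟨S, hfg, h1, hbi, hS⟩ := 𝒢.exists_generating_isBistable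
  obtain ⟨D, hD, hpt⟩ := 𝒢.exists_forall_eq_eval hfg h1 hS
  have hSk : S ≤ Subalgebra.toSubmodule 𝒢.kFun := by
    rw [← hS]; exact Algebra.subset_adjoin
  have hmulk : ∀ {A B : Submodule k (G → K)}, A ≤ Subalgebra.toSubmodule 𝒢.kFun →
      B ≤ Subalgebra.toSubmodule 𝒢.kFun → A * B ≤ Subalgebra.toSubmodule 𝒢.kFun := by
    intro A B hA hB
    rw [← 𝒢.kFun.isIdempotentElem_toSubmodule.eq]
    exact mul_le_mul' hA hB
  have hpowk : ∀ n, S ^ n ≤ Subalgebra.toSubmodule 𝒢.kFun := by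
    intro n
    induction n with
    | zero =>
      rw [pow_zero, Submodule.one_eq_span, Submodule.span_le]
      simp
    | succ n ih => rw [pow_succ]; exact hmulk ih hSk
  obtain ⟨m, f, hf, hfs⟩ := 𝒢.exists_basis (hfg.pow D) (hpowk D)
  obtain ⟨q, p, hp, hps⟩ := 𝒢.exists_basis ((hfg.pow D).mul (hfg.pow D))
    (hmulk (hpowk D) (hpowk D))
  have hfm : ∀ i, f i ∈ S ^ D := fun i => hfs ▸ Submodule.subset_span (Set.mem_range_self i)
  have hpm : ∀ i, p i ∈ S ^ D * S ^ D :=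
    fun i => hps ▸ Submodule.subset_span (Set.mem_range_self i)
  choose h hhm hh using fun j =>
    exists_coeff_of_mem_externalProduct hfs.ge (hbi.pow D (f j) (hfm j))
  choose Q hQm hQ using fun j =>
    exists_coeff_of_mem_externalProduct hps.ge (((hbi.pow D).mul (hbi.pow D)) (p j) (hpm j))
  have hcomb : ∀ g ∈ S ^ D, ∃ c : Fin m → k, ∀ x, g x = ∑ i, algebraMap k K (c i) * f i x := by
    intro g hg
    rw [← hfs] at hg
    obtain ⟨c, rfl⟩ := (Submodule.mem_span_range_iff_exists_fun k).1 hg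
    exact ⟨c, fun x => by simp [Finset.sum_apply, Algebra.smul_def]⟩
  have hcomb' : ∀ g ∈ S ^ D * S ^ D,
      ∃ c : Fin q → k, ∀ x, g x = ∑ i, algebraMap k K (c i) * p i x := by
    intro g hg
    rw [← hps] at hg
    obtain ⟨c, rfl⟩ := (Submodule.mem_span_range_iff_exists_fun k).1 hg
    exact ⟨c, fun x => by simp [Finset.sum_apply, Algebra.smul_def]⟩
  choose τ hτ using fun i j => hcomb (h j i) (hhm j i)
  have h1D : (1 : G → K) ∈ S ^ D := Submodule.one_le.1 (one_le_pow_of_one_le' h1 D)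
  obtain ⟨o, ho⟩ := hcomb 1 h1D
  choose c hc using fun i j => hcomb' (f i * f j) (Submodule.mul_mem_mul (hfm i) (hfm j))
  have hfK : Submodule.span K ((S ^ D : Submodule k (G → K)) : Set (G → K)) ≤
      Submodule.span K (Set.range f) := by
    rw [Submodule.span_le, ← hfs]
    exact Submodule.span_le_restrictScalars k K (Set.range f)
  refine ⟨⟨m, q, f, p, fun i j => h j i, fun i j => Q j i, τ, o, c, fun i => hpowk D (hfm i),
    fun i j => hpowk D (hhm j i), fun i j => hmulk (hpowk D) (hpowk D) (hQm j i), hf, hp,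
    hh, hQ, hτ, fun x => (ho x).symm, hc, ?_, ?_, ?_⟩⟩
  · intro s
    have hle : S ^ D * S ^ D ≤ (Submodule.span K
        (Set.range fun ij : Fin m × Fin m => f ij.1 * f ij.2)).restrictScalars k := by
      rw [← hfs, Submodule.span_mul_span, Submodule.span_le]
      rintro _ ⟨_, ⟨i, rfl⟩, _, ⟨j, rfl⟩, rfl⟩
      exact Submodule.subset_span ⟨(i, j), rfl⟩
    exact hle (hpm s)
  · apply le_antisymm
    · apply Algebra.adjoin_le
      rintro _ ⟨i, rfl⟩
      exact hpowk D (hfm i)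
    · rw [← hS]
      refine Algebra.adjoin_le fun g hg => ?_
      have : g ∈ S ^ D := pow_le_pow_right' h1 hD (by simpa using hg)
      rw [← hfs] at this
      exact Algebra.span_le_adjoin k _ this
  · intro l l' hl hll
    obtain ⟨Λ, hΛ⟩ := exists_linearMap_of_linearIndependent hf l
    obtain ⟨Λ', hΛ'⟩ := exists_linearMap_of_linearIndependent hp l'
    have hone : Λ 1 = 1 := by
      have : (1 : G → K) = ∑ i, algebraMap k K (o i) • f i := by
        ext x
        simpa [Finset.sum_apply, -algebraMap_smul] using ho x
      rw [this, map_sum, ← hl]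
      simp [hΛ, -algebraMap_smul]
    have hmul : ∀ a ∈ Submodule.span K (Set.range f), ∀ b ∈ Submodule.span K (Set.range f),
        Λ' (a * b) = Λ a * Λ b := by
      intro a ha b hb
      induction ha, hb using Submodule.span_induction₂ with
      | mem_mem a b ha hb =>
        obtain ⟨i, rfl⟩ := ha
        obtain ⟨j, rfl⟩ := hb
        have : f i * f j = ∑ s, algebraMap k K (c i j s) • p s := by
          ext x
          simpa [Finset.sum_apply, -algebraMap_smul] using hc i j x
        rw [this, map_sum, hΛ, hΛ, hll]
        simp [hΛ', -algebraMap_smul]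
      | zero_left => simp
      | zero_right => simp
      | add_left _ _ _ _ _ _ h h' => rw [add_mul, map_add, h, h', map_add, add_mul]
      | add_right _ _ _ _ _ _ h h' => rw [mul_add, map_add, h, h', map_add, mul_add]
      | smul_left t _ _ _ _ h => rw [smul_mul_assoc, map_smul, h, map_smul, smul_mul_assoc]
      | smul_right t _ _ _ _ h => rw [mul_smul_comm, map_smul, h, map_smul, mul_smul_comm]
    -- `Λ` lives on `F` and `Λ'` on `F * F`; since `1` is in `F` and `Λ 1 = 1`, the identity for `a
    -- * 1` makes them agree on `F`.
    have hΛΛ' : ∀ a ∈ Submodule.span K (Set.range f), Λ' a = Λ a := by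
      intro a ha
      have := hmul a ha 1 (hfK (Submodule.subset_span h1D))
      rwa [mul_one, hone, mul_one] at this
    obtain ⟨z, hz⟩ := hpt Λ hone fun a ha b hb hab => by
      rw [← hΛΛ' _ (hfK hab), hmul a (hfK ha) b (hfK hb)]
    exact ⟨z, fun i => by rw [← hΛ, hz _ (hfm i)]⟩

end Points

/-! ### The nonassociative algebra and its multiplication table. -/

/-- Indices for the basis of the algebra: the left unit, an element which generates a space of
elements fixed by the automorphisms, these fixed elements, and bases of a space `F` of functions, of
`F * F` and of the dual of `F * F`. -/
inductive BasisIndex (m q : ℕ)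
  | unit
  | gen
  | fix (i : Fin (m + 3))
  | fn (i : Fin m)
  | prod (s : Fin q)
  | dual (s : Fin q)
  deriving DecidableEq, Fintype

/-- Structure constants: of operators `τ i` on `R ^ m`, of a vector `o` in `R ^ m` and of a bilinear
map `c` from `R ^ m × R ^ m` to `R ^ q`. -/
structure StructureConstants (R : Type*) (m q : ℕ) where
  τ : Fin m → Fin m → Fin m → R
  o : Fin m → R
  c : Fin m → Fin m → Fin q → R

namespace StructureConstants

variable {R : Type*} [CommRing R] {m q : ℕ} (C : StructureConstants R m q)

/-- The image of structure constants under a ring homomorphism. -/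
def map {S : Type*} [CommRing S] (φ : R →+* S) : StructureConstants S m q where
  τ i j l := φ (C.τ i j l)
  o i := φ (C.o i)
  c i j s := φ (C.c i j s)

/-- The multiplication of the algebra with given structure constants, in coordinates. -/
def mulFun (x y : BasisIndex m q → R) : BasisIndex m q → R
  | .unit => x .unit * y .unit + ∑ s, x (.prod s) * y (.dual s)
  | .gen => x .unit * y .gen
  -- The chain: `gen * gen = fix 0` and `gen * fix j = fix (j + 1)`. The last term gives `fix 0 *
  -- gen = fix 0`, which prevents a rescaling of `gen`.
  | .fix i => x .unit * y (.fix i) + y .unit * x (.fix i) +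
      x .gen * (Fin.cases (y .gen) (fun j => y (.fix j.castSucc)) i : R) +
      if i = 0 then x (.fix 0) * y .gen else 0
  -- On functions, `fix 0` acts from the left as the identity and the first `m` vectors `fix i` act
  -- from the right as `τ i`. The overlap is harmless since the sides differ. The end of the chain
  -- produces the constant function: `gen * fix last = o`.
  | .fn l => x .unit * y (.fn l) + y .unit * x (.fn l) + x (.fix 0) * y (.fn l) +
      x .gen * y (.fix (Fin.last _)) * C.o l +
      ∑ i, ∑ j, C.τ i j l * x (.fn j) * y (.fix (Fin.castAdd 3 i))
  | .prod s => x .unit * y (.prod s) + y .unit * x (.prod s) + x (.fix 1) * y (.prod s) +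
      ∑ i, ∑ j, C.c i j s * (x (.fn i) * y (.fn j))
  | .dual s => x .unit * y (.dual s) + y .unit * x (.dual s) + x (.fix 2) * y (.dual s)

/-- The multiplication of the algebra with given structure constants. -/
def mul : (BasisIndex m q → R) →ₗ[R] (BasisIndex m q → R) →ₗ[R] (BasisIndex m q → R) :=
  LinearMap.mk₂ R C.mulFun
    (by
      intro x x' y
      ext i
      cases i <;> simp only [mulFun, Pi.add_apply, mul_add, add_mul, Finset.sum_add_distrib]
      case fix i => split_ifs <;> ring
      all_goals ring)
    (by
      intro t x y
      ext i
      cases i <;> simp only [mulFun, Pi.smul_apply, smul_eq_mul, mul_add, Finset.mul_sum]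
      case fix i => split_ifs <;> ring
      case gen => ring
      case dual => ring
      all_goals
        congr 1
        · ring
        · refine Finset.sum_congr rfl fun i _ => ?_
          try refine Finset.sum_congr rfl fun j _ => ?_
          ring)
    (by
      intro x y y'
      ext i
      cases i <;> simp only [mulFun, Pi.add_apply, mul_add, add_mul, Finset.sum_add_distrib]
      case fix i =>
        induction i using Fin.cases <;> simp <;> ring
      all_goals ring)
    (by
      intro t x y
      ext i
      cases i <;> simp only [mulFun, Pi.smul_apply, smul_eq_mul, mul_add, Finset.mul_sum]
      case fix i =>
        induction i using Fin.cases <;> simp <;> ring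
      case gen => ring
      case dual => ring
      all_goals
        congr 1
        · ring
        · refine Finset.sum_congr rfl fun i _ => ?_
          try refine Finset.sum_congr rfl fun j _ => ?_
          ring)

theorem mul_apply (x y : BasisIndex m q → R) : C.mul x y = C.mulFun x y := rfl

/-- The left unit of the algebra. -/
def unitVec (R : Type*) [CommRing R] (m q : ℕ) : BasisIndex m q → R := Pi.single .unit 1
/-- The generator of the fixed elements of the algebra. -/
def genVec (R : Type*) [CommRing R] (m q : ℕ) : BasisIndex m q → R := Pi.single .gen 1
/-- The fixed elements of the algebra. -/
def fixVec (R : Type*) [CommRing R] {m : ℕ} (q : ℕ) (i : Fin (m + 3)) : BasisIndex m q → R :=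
  Pi.single (.fix i) 1
/-- The inclusion of the space of functions in the algebra. -/
def ofFn (q : ℕ) (a : Fin m → R) : BasisIndex m q → R
  | .fn l => a l
  | _ => 0
/-- The inclusion of the space spanned by the products of functions in the algebra. -/
def ofProd (m : ℕ) (a : Fin q → R) : BasisIndex m q → R
  | .prod l => a l
  | _ => 0
/-- The inclusion of the dual of the space spanned by the products of functions in the algebra. -/
def ofDual (m : ℕ) (a : Fin q → R) : BasisIndex m q → R
  | .dual l => a l
  | _ => 0

theorem unitVec_mul (x : BasisIndex m q → R) : C.mul (unitVec R m q) x = x := by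
  ext i
  cases i <;> simp [mul_apply, mulFun, unitVec]

/-- The kernel of right multiplication by the left unit is the line of `gen`; this singles out that
line intrinsically. -/
theorem mul_unitVec (x : BasisIndex m q → R) :
    C.mul x (unitVec R m q) = Function.update x .gen 0 := by
  ext i
  cases i <;> simp [mul_apply, mulFun, unitVec]
  case fix i => induction i using Fin.cases <;> simp

theorem genVec_mul (x : BasisIndex m q → R) (i : BasisIndex m q) :
    C.mul (genVec R m q) x i = match i with
      | .fix j => Fin.cases (x .gen) (fun j => x (.fix j.castSucc)) j
      | .fn l => x (.fix (Fin.last _)) * C.o l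
      | _ => 0 := by
  cases i <;> simp [mul_apply, mulFun, genVec]

theorem mul_genVec (x : BasisIndex m q → R) :
    C.mul x (genVec R m q) = x .unit • genVec R m q + (x .gen + x (.fix 0)) • fixVec R q 0 := by
  ext i
  cases i <;> simp [mul_apply, mulFun, genVec, fixVec, Pi.single_apply]
  case fix i => induction i using Fin.cases <;> simp

theorem genVec_mul_genVec : C.mul (genVec R m q) (genVec R m q) = fixVec R q 0 := by
  rw [mul_genVec]
  simp [genVec]

theorem fixVec_zero_mul_genVec : C.mul (fixVec R q 0) (genVec R m q) = fixVec R q 0 := by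
  rw [mul_genVec]
  simp [fixVec]

theorem genVec_mul_fixVec (i : Fin (m + 2)) :
    C.mul (genVec R m q) (fixVec R q i.castSucc) = fixVec R q i.succ := by
  ext j
  rw [genVec_mul]
  cases j <;> simp [fixVec, Pi.single_apply]
  case fix j => induction j using Fin.cases <;> simp [eq_comm]

theorem genVec_mul_fixVec_last :
    C.mul (genVec R m q) (fixVec R q (Fin.last _)) = ofFn q C.o := by
  ext j
  rw [genVec_mul]
  cases j <;> simp [fixVec, ofFn]
  case fix j => induction j using Fin.cases <;> simp

theorem fin_two_ne_zero : (2 : Fin (m + 3)) ≠ 0 := fun h => by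
  simpa [Nat.mod_eq_of_lt (show 2 < m + 3 by omega)] using congrArg Fin.val h

theorem fin_two_ne_one : (2 : Fin (m + 3)) ≠ 1 := fun h => by
  simpa [Nat.mod_eq_of_lt (show 2 < m + 3 by omega)] using congrArg Fin.val h

theorem fixVec_zero_mul (x : BasisIndex m q → R) :
    C.mul (fixVec R q 0) x = ofFn q (fun l => x (.fn l)) + (x .unit + x .gen) • fixVec R q 0 := by
  ext i
  cases i <;> simp [fin_two_ne_zero, mul_apply, mulFun, fixVec, Pi.single_apply, ofFn]
  case fix i => induction i using Fin.cases <;> simp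

theorem fixVec_one_mul (x : BasisIndex m q → R) :
    C.mul (fixVec R q 1) x = ofProd m (fun l => x (.prod l)) + x .unit • fixVec R q 1 := by
  ext i
  cases i <;> simp [fin_two_ne_one, mul_apply, mulFun, fixVec, Pi.single_apply, ofProd]

theorem fixVec_two_mul (x : BasisIndex m q → R) :
    C.mul (fixVec R q 2) x = ofDual m (fun l => x (.dual l)) + x .unit • fixVec R q 2 := by
  ext i
  cases i <;> simp [fin_two_ne_one.symm, fin_two_ne_zero.symm, mul_apply, mulFun, fixVec, Pi.single_apply, ofDual]

theorem ofFn_mul_fixVec (a : Fin m → R) (i : Fin m) :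
    C.mul (ofFn q a) (fixVec R q (Fin.castAdd 3 i)) = ofFn q fun l => ∑ j, C.τ i j l * a j := by
  ext j
  cases j <;> simp [mul_apply, mulFun, fixVec, Pi.single_apply, ofFn]

theorem ofFn_mul_ofFn (a b : Fin m → R) :
    C.mul (ofFn q a) (ofFn q b) = ofProd m fun s => ∑ i, ∑ j, C.c i j s * (a i * b j) := by
  ext j
  cases j <;> simp [mul_apply, mulFun, ofProd, ofFn]

theorem ofProd_mul_ofDual (a b : Fin q → R) :
    C.mul (ofProd m a) (ofDual m b) = (∑ s, a s * b s) • unitVec R m q := by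
  ext j
  cases j <;> simp [mul_apply, mulFun, ofProd, ofDual, unitVec]

/-! ### Rigidity of the auxiliary vectors, and simplicity. -/

section Automorphisms

variable {K : Type*} [Field K] {C : StructureConstants K m q}
  {g : (BasisIndex m q → K) ≃ₗ[K] (BasisIndex m q → K)}

/-- The image `e` of the left unit is a left unit, by surjectivity of `g`. From `e * unit = unit`
all coordinates of `e` except that at `gen` are known, and the `fix 0` coordinate of `e * gen = gen`
shows that the remaining one is zero. -/
theorem map_unitVec (hg : ∀ x y, g (C.mul x y) = C.mul (g x) (g y)) :
    g (unitVec K m q) = unitVec K m q := by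
  have h : ∀ y, C.mul (g (unitVec K m q)) y = y := fun y => by
    obtain ⟨y, rfl⟩ := g.surjective y
    rw [← hg, unitVec_mul]
  have h1 := h (unitVec K m q)
  have h2 := congrFun (h (genVec K m q)) (.fix 0)
  rw [mul_unitVec] at h1
  have h3 : ∀ i, i ≠ .gen → g (unitVec K m q) i = unitVec K m q i := fun i hi => by
    rw [← congrFun h1 i, Function.update_of_ne hi]
  ext i
  by_cases hi : i = .gen
  · subst hi
    rw [mul_genVec, h3 (.fix 0) (by simp)] at h2
    simpa [unitVec, genVec, fixVec] using h2
  · exact h3 i hi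

theorem map_genVec (hg : ∀ x y, g (C.mul x y) = C.mul (g x) (g y)) :
    g (genVec K m q) = genVec K m q := by
  have h1 : C.mul (g (genVec K m q)) (unitVec K m q) = 0 := by
    rw [← map_unitVec hg, ← hg, mul_unitVec, genVec, Pi.single, Function.update_idem,
      ← Pi.single, Pi.single_zero, map_zero]
  rw [mul_unitVec] at h1
  obtain ⟨t, ht⟩ : ∃ t : K, g (genVec K m q) = t • genVec K m q := by
    refine ⟨g (genVec K m q) .gen, ?_⟩
    ext i
    by_cases hi : i = .gen
    · subst hi; simp [genVec]
    · have := congrFun h1 i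
      rw [Function.update_of_ne hi] at this
      rw [this]
      simp [genVec, hi]
  have ht0 : t ≠ 0 := by
    rintro rfl
    rw [zero_smul, LinearEquiv.map_eq_zero_iff] at ht
    simpa [genVec] using congrFun ht .gen
  have h2 := hg (genVec K m q) (genVec K m q)
  rw [genVec_mul_genVec, ht, map_smul, LinearMap.map_smul₂, genVec_mul_genVec] at h2
  -- With `g gen = t gen` one has `g (fix 0) = t² fix 0`; applying `g` to `fix 0 * gen = fix 0`
  -- gives `t³ = t²`, so `t = 1`.
  have h3 := hg (fixVec K q 0) (genVec K m q)
  rw [fixVec_zero_mul_genVec, h2, ht] at h3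
  simp only [map_smul, LinearMap.smul_apply, fixVec_zero_mul_genVec] at h3
  have h4 := congrFun h3 (.fix 0)
  simp only [fixVec, Pi.smul_apply, Pi.single_eq_same, smul_eq_mul, mul_one] at h4
  have h5 : t = 1 := by
    have : t * t ≠ 0 := mul_ne_zero ht0 ht0
    apply mul_left_cancel₀ this
    linear_combination -h4
  rw [ht, h5, one_smul]

theorem map_fixVec (hg : ∀ x y, g (C.mul x y) = C.mul (g x) (g y)) (i : Fin (m + 3)) :
    g (fixVec K q i) = fixVec K q i := by
  induction i using Fin.induction with
  | zero => rw [← C.genVec_mul_genVec, hg, map_genVec hg]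
  | succ i ih => rw [← C.genVec_mul_fixVec, hg, map_genVec hg, ih]

theorem map_ofFn_one (hg : ∀ x y, g (C.mul x y) = C.mul (g x) (g y)) :
    g (ofFn q C.o) = ofFn q C.o := by
  rw [← C.genVec_mul_fixVec_last, hg, map_genVec hg, map_fixVec hg]

/-- One multiplication by `fix 0` projects to the functions up to a multiple of `fix 0`; a second
one kills this error. As `fix 0` is fixed, the projection commutes with automorphisms, which
therefore preserve the block. The vectors `fix 1` and `fix 2` do the same for the other two blocks.
-/
theorem fixVec_zero_mul_fixVec_zero_mul (x : BasisIndex m q → K) :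
    C.mul (fixVec K q 0) (C.mul (fixVec K q 0) x) = ofFn q fun l => x (.fn l) := by
  rw [fixVec_zero_mul C x, fixVec_zero_mul]
  ext i
  cases i <;> simp [ofFn, fixVec]

theorem fixVec_one_mul_fixVec_one_mul (x : BasisIndex m q → K) :
    C.mul (fixVec K q 1) (C.mul (fixVec K q 1) x) = ofProd m fun l => x (.prod l) := by
  rw [fixVec_one_mul C x, fixVec_one_mul]
  ext i
  cases i <;> simp [ofProd, fixVec]

theorem fixVec_two_mul_fixVec_two_mul (x : BasisIndex m q → K) :
    C.mul (fixVec K q 2) (C.mul (fixVec K q 2) x) = ofDual m fun l => x (.dual l) := by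
  rw [fixVec_two_mul C x, fixVec_two_mul]
  ext i
  cases i <;> simp [ofDual, fixVec]

theorem map_ofFn (hg : ∀ x y, g (C.mul x y) = C.mul (g x) (g y)) (a : Fin m → K) :
    g (ofFn q a) = ofFn q fun l => g (ofFn q a) (.fn l) := by
  rw [← C.fixVec_zero_mul_fixVec_zero_mul, ← map_fixVec hg, ← hg, ← hg,
    fixVec_zero_mul_fixVec_zero_mul]
  rfl

theorem map_ofProd (hg : ∀ x y, g (C.mul x y) = C.mul (g x) (g y)) (a : Fin q → K) :
    g (ofProd m a) = ofProd m fun l => g (ofProd m a) (.prod l) := by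
  rw [← C.fixVec_one_mul_fixVec_one_mul, ← map_fixVec hg, ← hg, ← hg,
    fixVec_one_mul_fixVec_one_mul]
  rfl

theorem map_ofDual (hg : ∀ x y, g (C.mul x y) = C.mul (g x) (g y)) (a : Fin q → K) :
    g (ofDual m a) = ofDual m fun l => g (ofDual m a) (.dual l) := by
  rw [← C.fixVec_two_mul_fixVec_two_mul, ← map_fixVec hg, ← hg, ← hg,
    fixVec_two_mul_fixVec_two_mul]
  rfl

/-- Every coordinate leads to the left unit: `gen` raises `gen` and the `fix i` along the chain to a
multiple of `o`; a function times `o` is a nonzero element of the product block by `hc`; product and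
dual vectors pair to a multiple of the unit. An element with none of these coordinates is itself a
multiple of the unit. -/
theorem isSimpleAlgebra_mul (ho : C.o ≠ 0)
    (hc : ∀ a : Fin m → K, (∀ s, ∑ i, ∑ j, C.c i j s * (a i * C.o j) = 0) → a = 0) :
    IsSimpleAlgebra C.mul := by
  refine ⟨fun h => ?_, fun I hI => ?_⟩
  · have := C.unitVec_mul (unitVec K m q)
    rw [h] at this
    simpa [unitVec] using congrFun this .unit
  have hl : ∀ x ∈ I, ∀ y, C.mul y x ∈ I := fun x hx y => (hI x hx y).2
  have hr : ∀ x ∈ I, ∀ y, C.mul x y ∈ I := fun x hx y => (hI x hx y).1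
  have hunit : ∀ t : K, t ≠ 0 → t • unitVec K m q ∈ I → I = ⊤ := by
    intro t ht h
    have h1 := I.smul_mem t⁻¹ h
    rw [smul_smul, inv_mul_cancel₀ ht, one_smul] at h1
    refine eq_top_iff.2 fun x _ => ?_
    rw [← C.unitVec_mul x]
    exact hr _ h1 _
  have hprod : ∀ x ∈ I, ∀ s, x (.prod s) ≠ 0 → I = ⊤ := by
    intro x hx s hs
    have h := hr _ (hl _ (hl _ hx (fixVec K q 1)) (fixVec K q 1)) (ofDual m (Pi.single s 1))
    rw [fixVec_one_mul_fixVec_one_mul, ofProd_mul_ofDual] at h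
    exact hunit _ (by simpa [Pi.single_apply] using hs) h
  have hdual : ∀ x ∈ I, ∀ s, x (.dual s) ≠ 0 → I = ⊤ := by
    intro x hx s hs
    have h := hl _ (hl _ (hl _ hx (fixVec K q 2)) (fixVec K q 2)) (ofProd m (Pi.single s 1))
    rw [fixVec_two_mul_fixVec_two_mul, ofProd_mul_ofDual] at h
    exact hunit _ (by simpa [Pi.single_apply] using hs) h
  have hfn : ∀ x ∈ I, ∀ i, x (.fn i) ≠ 0 → I = ⊤ := by
    intro x hx i hi
    have h := hr _ (hl _ (hl _ hx (fixVec K q 0)) (fixVec K q 0)) (ofFn q C.o)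
    rw [fixVec_zero_mul_fixVec_zero_mul, ofFn_mul_ofFn] at h
    by_contra hne
    have h0 : (fun l => x (.fn l)) = 0 := hc _ fun s => by
      by_contra hs
      exact hne (hprod _ h s hs)
    exact hi (congrFun h0 i)
  have hfix : ∀ i : Fin (m + 3), ∀ x ∈ I, x (.fix i) ≠ 0 → I = ⊤ := by
    intro i
    induction i using Fin.reverseInduction with
    | last =>
      intro x hx hi
      obtain ⟨l, hl'⟩ := Function.ne_iff.1 ho
      refine hfn _ (hl _ hx (genVec K m q)) l ?_
      rw [genVec_mul]
      exact mul_ne_zero hi hl'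
    | cast i ih =>
      intro x hx hi
      refine ih _ (hl _ hx (genVec K m q)) ?_
      rw [genVec_mul]
      simpa using hi
  have hgen : ∀ x ∈ I, x .gen ≠ 0 → I = ⊤ := by
    intro x hx hi
    refine hfix 0 _ (hl _ hx (genVec K m q)) ?_
    rw [genVec_mul]
    simpa using hi
  by_contra! hne
  obtain ⟨hbot, htop⟩ := hne
  obtain ⟨x, hx, hx0⟩ := I.ne_bot_iff.1 hbot
  have hxu : x = x .unit • unitVec K m q := by
    ext i
    cases i with
    | unit => simp [unitVec]
    | gen => simpa [unitVec] using not_not.1 (mt (hgen x hx) htop)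
    | fix i => simpa [unitVec] using not_not.1 (mt (hfix i x hx) htop)
    | fn i => simpa [unitVec] using not_not.1 (mt (hfn x hx i) htop)
    | prod i => simpa [unitVec] using not_not.1 (mt (hprod x hx i) htop)
    | dual i => simpa [unitVec] using not_not.1 (mt (hdual x hx i) htop)
  refine htop (hunit (x .unit) (fun h => hx0 ?_) (hxu ▸ hx))
  rw [hxu, h, zero_smul]

end Automorphisms

end StructureConstants
-- Structure tensors and their stabilizers.
section Tensors

variable {F : Type u} [Field F] {W : Type w} [AddCommGroup W] [Module F W]

theorem tensorMul_tmul (f l : Module.Dual F W) (w x y : W) :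
    tensorMul F W (f ⊗ₜ (l ⊗ₜ w)) x y = f x • l y • w := by
  simp [tensorMul]

theorem tensorMul_tensorRep (g : W ≃ₗ[F] W) (t : StructureTensor F W) (x y : W) :
    tensorMul F W (tensorRep F W g t) x y = g (tensorMul F W t (g.symm x) (g.symm y)) := by
  induction t using TensorProduct.induction_on with
  | zero => simp
  | add t t' h h' => simp only [map_add, LinearMap.add_apply, h, h']
  | tmul f s =>
    induction s using TensorProduct.induction_on with
    | zero => simp
    | add t t' h h' => simp only [TensorProduct.tmul_add, map_add, LinearMap.add_apply, h, h']
    | tmul l w =>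
      have : tensorRep F W g (f ⊗ₜ (l ⊗ₜ w)) =
          (f ∘ₗ g.symm.toLinearMap) ⊗ₜ ((l ∘ₗ g.symm.toLinearMap) ⊗ₜ g w) := rfl
      rw [this, tensorMul_tmul, tensorMul_tmul]
      simp

theorem tensorMul_injective [FiniteDimensional F W] : Function.Injective (tensorMul F W) := by
  have h1 : Function.Injective (dualTensorHom F W (W →ₗ[F] W)) :=
    (dualTensorHomEquiv F W (W →ₗ[F] W)).injective
  have h2 : Function.Injective ((dualTensorHom F W W).lTensor (Module.Dual F W)) :=
    ((dualTensorHomEquiv F W W).lTensor (Module.Dual F W)).injective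
  exact h1.comp h2

/-- In finite dimension a tensor is determined by its multiplication, and `g` acts on
multiplications by transport of structure; being fixed means being compatible with `g`. -/
theorem tensorStabilizer_eq_autGroup [FiniteDimensional F W] (t : StructureTensor F W) :
    tensorStabilizer t = autGroup (tensorMul F W t) := by
  ext g
  change tensorRep F W g t = t ↔ ∀ x y, g (tensorMul F W t x y) = tensorMul F W t (g x) (g y)
  rw [← tensorMul_injective.eq_iff]
  constructor
  · intro h x y
    conv_rhs => rw [← h]
    rw [tensorMul_tensorRep]
    simp
  · intro h
    ext x y
    rw [tensorMul_tensorRep, h]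
    simp

variable {k : Type u} (K : Type v) [Field k] [Field K] [Algebra k K]
variable {V : Type w} [AddCommGroup V] [Module k V]

@[simp]
theorem extendForm_tmul (φ : Module.Dual k V) (a : K) (x : V) :
    extendForm K φ (a ⊗ₜ[k] x) = a * algebraMap k K (φ x) := by
  simp [extendForm]

theorem exists_rational_structureTensor [FiniteDimensional k V] (μ : V →ₗ[k] V →ₗ[k] V) :
    ∃ t ∈ rationalTensors K V, tensorMul K (K ⊗[k] V) t = LinearMap.BilinMap.baseChange K μ := by
  let b := Module.finBasis k V
  refine ⟨∑ i, ∑ j, extendForm K (b.coord i) ⊗ₜ[K]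
    (extendForm K (b.coord j) ⊗ₜ[K] ((1 : K) ⊗ₜ[k] μ (b i) (b j))), ?_, ?_⟩
  · exact Submodule.sum_mem _ fun i _ => Submodule.sum_mem _ fun j _ =>
      Submodule.subset_span ⟨_, _, _, rfl⟩
  · refine (Algebra.TensorProduct.basis K b).ext fun i => (Algebra.TensorProduct.basis K b).ext
      fun j => ?_
    simp only [map_sum, LinearMap.sum_apply, tensorMul_tmul, Algebra.TensorProduct.basis_apply,
      extendForm_tmul, LinearMap.BilinMap.baseChange_tmul, Module.Basis.coord_apply,
      Module.Basis.repr_self]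
    rw [Finset.sum_eq_single i, Finset.sum_eq_single j]
    · simp
    · intro j' _ hj'
      simp [Finsupp.single_eq_of_ne hj']
    · simp
    · intro j' _ hj'
      simp [Finsupp.single_eq_of_ne hj']
    · simp

end Tensors

/-! ### Closed subgroups defined over `k` as images of embeddings. -/

section ClosedSubgroups

variable {k : Type u} {K : Type v} [Field k] [Field K] [Algebra k K]

theorem adjoin_coe_subalgebra_eq_span {X : Type*} (A : Subalgebra k (X → K)) {f : X → K}
    (hf : f ∈ Algebra.adjoin K (A : Set (X → K))) : f ∈ Submodule.span K (A : Set (X → K)) := by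
  have := Algebra.adjoin_eq_span K (A : Set (X → K))
  rw [← Subalgebra.mem_toSubmodule, this] at hf
  have h2 : Submonoid.closure (A : Set (X → K)) = A.toSubmonoid :=
    Submonoid.closure_eq A.toSubmonoid
  rw [h2] at hf
  exact hf

/-- If `f` is a `K`-combination of functions from `k[Y]` and its pullback to a variety `X` vanishes,
then it is a `K`-combination of functions from `k[Y]` whose pullbacks vanish. -/
theorem AffineKVariety.mem_span_of_comp_eq_zero {X : Type w} (𝒳 : AffineKVariety k K X)
    {Y : Type*} {A : Subalgebra k (Y → K)} {ρ : X → Y} (hρ : ∀ f ∈ A, f ∘ ρ ∈ 𝒳.kFun) {f : Y → K}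
    (hf : f ∈ Submodule.span K (A : Set (Y → K))) (h0 : f ∘ ρ = 0) :
    f ∈ Submodule.span K {g : Y → K | g ∈ A ∧ g ∘ ρ = 0} := by
  classical
  -- Expanding along a basis of `K` over `k` shows that the kernel of the extended restriction map
  -- is the extension of its kernel over `k`: each coefficient must restrict to zero.
  let b := Module.Basis.ofVectorSpace k K
  let ψ : K ⊗[k] A →ₗ[K] (Y → K) :=
    (Algebra.TensorProduct.productLeftAlgHom (Algebra.ofId K (Y → K)) A.val).toLinearMap
  have hψ : ∀ (a : K) (g : A), ψ (a ⊗ₜ g) = a • g.1 := fun a g => by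
    ext y; simp [ψ]
  obtain ⟨t, rfl⟩ : ∃ t, ψ t = f := by
    have : Submodule.span K (A : Set (Y → K)) ≤ LinearMap.range ψ := by
      rw [Submodule.span_le]
      intro g hg
      exact ⟨1 ⊗ₜ ⟨g, hg⟩, by simp [hψ]⟩
    exact this hf
  let r : A →ₗ[k] 𝒳.kFun :=
    { toFun := fun g => ⟨g.1 ∘ ρ, hρ g.1 g.2⟩
      map_add' := fun _ _ => rfl
      map_smul' := fun _ _ => rfl }
  have h1 : ∀ t : K ⊗[k] A, Algebra.TensorProduct.productLeftAlgHom (Algebra.ofId K (X → K))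
      𝒳.kFun.val (r.lTensor K t) = ψ t ∘ ρ := by
    intro t
    induction t using TensorProduct.induction_on with
    | zero => ext; simp
    | add t t' h h' => rw [map_add, map_add, h, h', map_add]; rfl
    | tmul a g => ext x; simp [hψ, r]
  have h2 : r.lTensor K t = 0 := by
    apply 𝒳.baseChange_injective
    rw [h1, h0, map_zero]
  let c := TensorProduct.equivFinsuppOfBasisLeft (N := A) b t
  have h3 : ∀ i, r (c i) = 0 := by
    intro i
    have h4 : ∀ t : K ⊗[k] A, TensorProduct.equivFinsuppOfBasisLeft (N := 𝒳.kFun) b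
        (r.lTensor K t) i = r (TensorProduct.equivFinsuppOfBasisLeft (N := A) b t i) := by
      intro t
      induction t using TensorProduct.induction_on with
      | zero => simp
      | add t t' h h' => simp only [map_add, Finsupp.add_apply, h, h']
      | tmul a g => simp
    rw [← h4, h2]
    simp
  have h5 : t = c.sum fun i g => b i ⊗ₜ g := by
    rw [← TensorProduct.equivFinsuppOfBasisLeft_symm_apply]
    simp [c]
  rw [h5, Finsupp.sum, map_sum]
  refine Submodule.sum_mem _ fun i _ => ?_
  rw [hψ]
  refine Submodule.smul_mem _ _ (Submodule.subset_span ⟨(c i).2, ?_⟩)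
  exact congrArg Subtype.val (h3 i)

/-- The image of a closed embedding of `k`-groups which is closed is defined over `k` and
`k`-isomorphic to the source. -/
theorem LinearAlgebraicKGroup.isClosedDefinedOver_and_kIsomorphic {G : Type w} [Group G]
    (𝒢 : LinearAlgebraicKGroup k K G) {X : Type*} [Group X] {A : Subalgebra k (X → K)}
    {H : Subgroup X} (ρ : G →* X) (hH : ρ.range = H)
    (hcl : ∀ x, (∀ f ∈ A, (∀ y ∈ H, f y = 0) → f x = 0) → x ∈ H)
    (hρ : ∀ f ∈ A, f ∘ ρ ∈ 𝒢.kFun) (hsurj : ∀ f ∈ 𝒢.kFun, ∃ g ∈ A, g ∘ ρ = f) :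
    IsClosedDefinedOver A (H : Set X) ∧ KIsomorphic 𝒢.kFun (restrictFun A H) := by
  subst hH
  refine ⟨⟨hcl, fun f hf hf0 => ?_⟩, ?_⟩
  · have h := 𝒢.mem_span_of_comp_eq_zero hρ (adjoin_coe_subalgebra_eq_span A hf)
      (funext fun x => hf0 _ ⟨x, rfl⟩)
    refine Submodule.span_mono ?_ h
    rintro g ⟨hg, hg0⟩
    refine ⟨hg, ?_⟩
    rintro _ ⟨x, rfl⟩
    exact congrFun hg0 x
  · have hinj : Function.Injective ρ := by
      intro x y hxy
      have h1 : ∀ f ∈ 𝒢.kFun, f x = f y := by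
        intro f hf
        obtain ⟨g, -, rfl⟩ := hsurj f hf
        simp [hxy]
      have h2 : ∀ f ∈ Algebra.adjoin K (𝒢.kFun : Set (G → K)), f x = f y := by
        intro f hf
        induction hf using Algebra.adjoin_induction with
        | mem f hf => exact h1 f hf
        | algebraMap c => simp
        | add f g _ _ h h' => simp [h, h']
        | mul f g _ _ h h' => simp [h, h']
      -- Regular functions separate points: two points with equal values give the same homomorphism
      -- `K[G] → K`, and its point is unique.
      refine (𝒢.points ((Pi.evalAlgHom K (fun _ : G => K) x).comp
        (Algebra.adjoin K (𝒢.kFun : Set (G → K))).val)).unique (fun f => rfl) fun f => ?_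
      exact h2 f.1 f.2
    refine ⟨MonoidHom.ofInjective hinj, fun f => ⟨?_, fun hf => ?_⟩⟩
    · rintro ⟨g, hg, rfl⟩
      exact hρ g hg
    · obtain ⟨g, hg, hgf⟩ := hsurj _ hf
      refine ⟨g, hg, funext fun y => ?_⟩
      obtain ⟨x, rfl⟩ := (MonoidHom.ofInjective hinj).surjective y
      exact (congrFun hgf x).symm

variable {V : Type w} [AddCommGroup V] [Module k V]

theorem matrixCoeff_mem_glFun (φ : Module.Dual k V) (x : V) :
    (fun g : GLK k K V => extendForm K φ (g (1 ⊗ₜ[k] x))) ∈ glFun k K V :=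
  Algebra.subset_adjoin (Or.inl ⟨φ, x, rfl⟩)

theorem eq_sum_extendForm_coord [FiniteDimensional k V] (z : K ⊗[k] V) :
    z = ∑ i, extendForm K ((Module.finBasis k V).coord i) z • 1 ⊗ₜ[k] Module.finBasis k V i := by
  set b := Module.finBasis k V
  induction z using TensorProduct.induction_on with
  | zero => simp
  | add t t' h h' =>
    simp only [map_add, add_smul, Finset.sum_add_distrib]
    rw [← h, ← h']
  | tmul a x =>
    conv_lhs => rw [← b.sum_repr x, TensorProduct.tmul_sum]
    refine Finset.sum_congr rfl fun i _ => ?_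
    rw [extendForm_tmul, mul_smul, algebraMap_smul, TensorProduct.tmul_smul, smul_comm a,
      TensorProduct.smul_tmul' a, smul_eq_mul, mul_one]
    rfl

theorem eq_of_forall_extendForm_eq [FiniteDimensional k V] {y z : K ⊗[k] V}
    (h : ∀ φ : Module.Dual k V, extendForm K φ y = extendForm K φ z) : y = z := by
  rw [eq_sum_extendForm_coord y, eq_sum_extendForm_coord z]
  simp only [h]

/-- The automorphism group of an algebra is closed. -/
theorem mem_autGroup_baseChange_of_forall [FiniteDimensional k V] (μ : V →ₗ[k] V →ₗ[k] V)
    {g : GLK k K V} (hg : ∀ f ∈ glFun k K V,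
      (∀ y ∈ autGroup (LinearMap.BilinMap.baseChange K μ), f y = 0) → f g = 0) :
    g ∈ autGroup (LinearMap.BilinMap.baseChange K μ) := by
  set b := Module.finBasis k V with hb
  -- Multiplicativity on vectors of `V` is the vanishing of polynomials in the matrix coefficients,
  -- with coefficients `φ(μ(b i, b j))` in `k`; by bilinearity these vectors suffice.
  have key : ∀ x y : V, g (LinearMap.BilinMap.baseChange K μ (1 ⊗ₜ x) (1 ⊗ₜ y)) =
      LinearMap.BilinMap.baseChange K μ (g (1 ⊗ₜ x)) (g (1 ⊗ₜ y)) := by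
    intro x y
    refine eq_of_forall_extendForm_eq fun φ => sub_eq_zero.1 (hg (fun g => extendForm K φ
      (g (LinearMap.BilinMap.baseChange K μ (1 ⊗ₜ x) (1 ⊗ₜ y))) - extendForm K φ
      (LinearMap.BilinMap.baseChange K μ (g (1 ⊗ₜ x)) (g (1 ⊗ₜ y)))) ?_ fun h hh => ?_)
    · refine (glFun k K V).sub_mem ?_ ?_
      · simp only [LinearMap.BilinMap.baseChange_tmul, mul_one]
        exact matrixCoeff_mem_glFun φ _
      · have : (fun g : GLK k K V => extendForm K φ
            (LinearMap.BilinMap.baseChange K μ (g (1 ⊗ₜ x)) (g (1 ⊗ₜ y)))) =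
            ∑ i, ∑ j, φ (μ (b i) (b j)) •
              ((fun g : GLK k K V => extendForm K (b.coord i) (g (1 ⊗ₜ x))) *
              fun g : GLK k K V => extendForm K (b.coord j) (g (1 ⊗ₜ y))) := by
          ext g
          conv_lhs => rw [eq_sum_extendForm_coord (g (1 ⊗ₜ x)), eq_sum_extendForm_coord (g (1 ⊗ₜ y))]
          simp only [map_sum, LinearMap.sum_apply, map_smul, LinearMap.smul_apply,
            LinearMap.BilinMap.baseChange_tmul, extendForm_tmul, Finset.sum_apply, Pi.smul_apply,
            Pi.mul_apply, smul_eq_mul, ← hb, Finset.mul_sum]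
          rw [Finset.sum_comm]
          refine Finset.sum_congr rfl fun i _ => Finset.sum_congr rfl fun j _ => ?_
          rw [Algebra.smul_def]
          ring
        rw [this]
        exact Subalgebra.sum_mem _ fun i _ => Subalgebra.sum_mem _ fun j _ =>
          Subalgebra.smul_mem _ (Subalgebra.mul_mem _ (matrixCoeff_mem_glFun _ _)
            (matrixCoeff_mem_glFun _ _)) _
    · rw [hh, sub_self]
  intro x y
  induction x using TensorProduct.induction_on with
  | zero => simp
  | add t t' h h' => simp only [map_add, LinearMap.add_apply, h, h']
  | tmul a x =>
    induction y using TensorProduct.induction_on with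
    | zero => simp
    | add t t' h h' => simp only [map_add, h, h']
    | tmul c y =>
      have ha : a ⊗ₜ[k] x = a • (1 ⊗ₜ[k] x) := by simp [TensorProduct.smul_tmul']
      have hc : c ⊗ₜ[k] y = c • (1 ⊗ₜ[k] y) := by simp [TensorProduct.smul_tmul']
      rw [ha, hc]
      simp only [map_smul, LinearMap.smul_apply, key]

end ClosedSubgroups

/-! ### Extension of scalars in coordinates, and matrix coefficients. -/

namespace StructureConstants

variable {m q : ℕ}

theorem map_mulFun {R S : Type*} [CommRing R] [CommRing S] (φ : R →+* S)
    (C : StructureConstants R m q) (x y : BasisIndex m q → R) (i : BasisIndex m q) :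
    φ (C.mulFun x y i) = (C.map φ).mulFun (φ ∘ x) (φ ∘ y) i := by
  cases i <;> simp [mulFun, map]
  case fix i =>
    rw [apply_ite φ]
    induction i using Fin.cases <;> simp

variable {k : Type u} (K : Type v) [Field k] [Field K] [Algebra k K]

/-- The coordinates on the extension of scalars of a space of functions. -/
noncomputable def coordEquiv (ι : Type*) [Fintype ι] [DecidableEq ι] : K ⊗[k] (ι → k) ≃ₗ[K] (ι → K) :=
  TensorProduct.piScalarRight k K K ι

theorem coordEquiv_tmul {ι : Type*} [Fintype ι] [DecidableEq ι] (a : K) (x : ι → k) :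
    coordEquiv K ι (a ⊗ₜ x) = a • (algebraMap k K ∘ x) := by
  ext i
  simp [coordEquiv, Algebra.smul_def, mul_comm]

theorem coordEquiv_baseChange_mul (C : StructureConstants k m q)
    (x y : K ⊗[k] (BasisIndex m q → k)) :
    coordEquiv K _ (LinearMap.BilinMap.baseChange K C.mul x y) =
      (C.map (algebraMap k K)).mul (coordEquiv K _ x) (coordEquiv K _ y) := by
  induction x using TensorProduct.induction_on with
  | zero => simp
  | add t t' h h' => simp only [map_add, LinearMap.add_apply, h, h']
  | tmul a x =>
    induction y using TensorProduct.induction_on with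
    | zero => simp
    | add t t' h h' => simp only [map_add, h, h']
    | tmul c y =>
      simp only [LinearMap.BilinMap.baseChange_tmul, coordEquiv_tmul, map_smul,
        LinearMap.smul_apply]
      ext i
      have := map_mulFun (algebraMap k K) C x y i
      simp only [Pi.smul_apply, Function.comp_apply, mul_apply, smul_eq_mul, this]
      ring

theorem extendForm_coordEquiv_symm {ι : Type*} [Fintype ι] [DecidableEq ι]
    (φ : Module.Dual k (ι → k)) (v : ι → K) :
    extendForm K φ ((coordEquiv (k := k) K ι).symm v) =
      ∑ i, algebraMap k K (φ (Pi.single i 1)) * v i := by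
  obtain ⟨z, rfl⟩ := (coordEquiv (k := k) K ι).surjective v
  rw [LinearEquiv.symm_apply_apply]
  induction z using TensorProduct.induction_on with
  | zero => simp
  | add t t' h h' => simp only [map_add, h, h', Pi.add_apply, mul_add, Finset.sum_add_distrib]
  | tmul a x =>
    rw [extendForm_tmul, coordEquiv_tmul]
    have hx : x = ∑ i, x i • Pi.single i (1 : k) := by
      ext j; simp [Finset.sum_apply, Pi.single_apply]
    conv_lhs => rw [hx, map_sum, map_sum, Finset.mul_sum]
    refine Finset.sum_congr rfl fun i _ => ?_
    rw [map_smul, smul_eq_mul, map_mul, Pi.smul_apply, smul_eq_mul, Function.comp_apply]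
    ring

end StructureConstants

theorem coeff_eq_of_forall_sum_eq {K : Type*} [Field K] {X ι : Type*} [Fintype ι] {e : ι → X → K}
    (he : LinearIndependent K e) {a b : ι → K} (h : ∀ x, ∑ i, a i * e i x = ∑ i, b i * e i x) :
    a = b := by
  have := Fintype.linearIndependent_iff.1 he (a - b) ?_
  · exact funext fun i => sub_eq_zero.1 (this i)
  · ext x
    simpa [Finset.sum_apply, sub_mul, sub_eq_zero] using h x

/-- The matrix coefficients of a basis of a space of functions. -/
theorem matrixCoeff_mul {K : Type*} [Field K] {G ι : Type*} [Group G] [Fintype ι] {e : ι → G → K}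
    (he : LinearIndependent K e) {h : ι → ι → G → K}
    (hh : ∀ j x y, e j (x * y) = ∑ i, e i x * h i j y) (l j : ι) (x y : G) :
    h l j (x * y) = ∑ i, h l i x * h i j y := by
  refine congrFun (coeff_eq_of_forall_sum_eq he (a := fun l => h l j (x * y))
    (b := fun l => ∑ i, h l i x * h i j y) fun z => ?_) l
  have h1 := hh j z (x * y)
  rw [← mul_assoc, hh j (z * x) y, Finset.sum_congr rfl fun i _ => by rw [hh i z x]] at h1
  simp only [Finset.sum_mul] at h1 ⊢
  rw [Finset.sum_congr rfl fun i _ => mul_comm (h i j (x * y)) (e i z), ← h1, Finset.sum_comm]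
  exact Finset.sum_congr rfl fun i _ => Finset.sum_congr rfl fun j _ => by ring

theorem matrixCoeff_one {K : Type*} [Field K] {G ι : Type*} [Group G] [Fintype ι] [DecidableEq ι]
    {e : ι → G → K} (he : LinearIndependent K e) {h : ι → ι → G → K}
    (hh : ∀ j x y, e j (x * y) = ∑ i, e i x * h i j y) (l j : ι) :
    h l j 1 = if l = j then 1 else 0 := by
  refine congrFun (coeff_eq_of_forall_sum_eq he (a := fun l => h l j 1)
    (b := fun l => if l = j then 1 else 0) fun z => ?_) l
  have h1 := hh j z 1
  rw [mul_one] at h1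
  simp [h1, mul_comm]

/-! ### The group acts by automorphisms of the algebra. -/

namespace FunctionModel

variable {k : Type u} {K : Type v} [Field k] [Field K] [Algebra k K] {G : Type w} [Group G]
  {𝒢 : LinearAlgebraicKGroup k K G} (M : FunctionModel 𝒢)

/-- The structure constants over `k` of a function model. -/
def constants : StructureConstants k M.m M.q := ⟨M.τ, M.o, M.c⟩

/-- The structure constants over `K` of a function model. -/
abbrev constantsK : StructureConstants K M.m M.q := M.constants.map (algebraMap k K)

theorem h_mul (l j x y) : M.h l j (x * y) = ∑ i, M.h l i x * M.h i j y :=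
  matrixCoeff_mul M.f_indep M.f_mul l j x y

theorem h_one (l j) : M.h l j 1 = if l = j then 1 else 0 := matrixCoeff_one M.f_indep M.f_mul l j

theorem Q_mul (l j x y) : M.Q l j (x * y) = ∑ i, M.Q l i x * M.Q i j y :=
  matrixCoeff_mul M.p_indep M.p_mul l j x y

theorem Q_one (l j) : M.Q l j 1 = if l = j then 1 else 0 := matrixCoeff_one M.p_indep M.p_mul l j

/-- Right translation by `z` commutes with `τ i`: expand `h i n (x * z)` in two ways and compare the
coefficients of `f p x`. -/
theorem sum_τ_h (z : G) (i n p) : ∑ l, algebraMap k K (M.τ i n l) * M.h p l z =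
    ∑ j, algebraMap k K (M.τ i j p) * M.h j n z := by
  refine congrFun (coeff_eq_of_forall_sum_eq M.f_indep
    (a := fun p => ∑ l, algebraMap k K (M.τ i n l) * M.h p l z)
    (b := fun p => ∑ j, algebraMap k K (M.τ i j p) * M.h j n z) fun x => ?_) p
  have h1 := M.h_mul i n x z
  rw [M.h_eq] at h1
  simp only [M.f_mul, M.h_eq i _ x, Finset.mul_sum, Finset.sum_mul] at h1 ⊢
  rw [Finset.sum_comm] at h1
  convert h1 using 1
  · exact Finset.sum_congr rfl fun _ _ => Finset.sum_congr rfl fun _ _ => by ring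
  · rw [Finset.sum_comm]
    exact Finset.sum_congr rfl fun _ _ => Finset.sum_congr rfl fun _ _ => by ring

/-- Constants are invariant under translation: compare the expansions of `1` at `x` and at `x * z`.
-/
theorem sum_h_o (z : G) (l) :
    ∑ j, M.h l j z * algebraMap k K (M.o j) = algebraMap k K (M.o l) := by
  refine congrFun (coeff_eq_of_forall_sum_eq M.f_indep
    (a := fun l => ∑ j, M.h l j z * algebraMap k K (M.o j))
    (b := fun l => algebraMap k K (M.o l)) fun x => ?_) l
  rw [M.one_eq, ← M.one_eq (x * z)]
  simp only [M.f_mul, Finset.mul_sum, Finset.sum_mul]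
  rw [Finset.sum_comm]
  exact Finset.sum_congr rfl fun _ _ => Finset.sum_congr rfl fun _ _ => by ring

/-- The translate of a product is the product of the translates, written on the basis `p`. -/
theorem sum_Q_c (z : G) (i j t) : ∑ s, M.Q t s z * algebraMap k K (M.c i j s) =
    ∑ i', ∑ j', algebraMap k K (M.c i' j' t) * (M.h i' i z * M.h j' j z) := by
  refine congrFun (coeff_eq_of_forall_sum_eq M.p_indep
    (a := fun t => ∑ s, M.Q t s z * algebraMap k K (M.c i j s))
    (b := fun t => ∑ i', ∑ j', algebraMap k K (M.c i' j' t) * (M.h i' i z * M.h j' j z))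
    fun x => ?_) t
  have h1 := M.mul_eq i j (x * z)
  rw [M.f_mul, M.f_mul, Finset.sum_mul_sum] at h1
  calc _ = ∑ s, algebraMap k K (M.c i j s) * M.p s (x * z) := by
        simp only [M.p_mul, Finset.mul_sum, Finset.sum_mul]
        rw [Finset.sum_comm]
        exact Finset.sum_congr rfl fun _ _ => Finset.sum_congr rfl fun _ _ => by ring
    _ = ∑ i', ∑ j', (∑ s, algebraMap k K (M.c i' j' s) * M.p s x) *
          (M.h i' i z * M.h j' j z) := by
        rw [← h1]
        refine Finset.sum_congr rfl fun i' _ => Finset.sum_congr rfl fun j' _ => ?_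
        rw [← M.mul_eq]
        ring
    _ = _ := by
        simp only [Finset.sum_mul]
        rw [Finset.sum_congr rfl fun _ _ => Finset.sum_comm, Finset.sum_comm]
        exact Finset.sum_congr rfl fun _ _ => Finset.sum_congr rfl fun _ _ =>
          Finset.sum_congr rfl fun _ _ => by ring

/-- The action of the group on the algebra, in coordinates. -/
def actFun (z : G) (x : BasisIndex M.m M.q → K) : BasisIndex M.m M.q → K
  | .unit => x .unit
  | .gen => x .gen
  | .fix i => x (.fix i)
  | .fn l => ∑ j, M.h l j z * x (.fn j)
  | .prod s => ∑ t, M.Q s t z * x (.prod t)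
  | .dual s => ∑ t, M.Q t s z⁻¹ * x (.dual t)

/-- The linear action of an element of the group on the algebra. -/
def act (z : G) : (BasisIndex M.m M.q → K) →ₗ[K] (BasisIndex M.m M.q → K) where
  toFun := M.actFun z
  map_add' x y := by
    ext i
    cases i <;> simp [actFun, mul_add, Finset.sum_add_distrib]
  map_smul' t x := by
    ext i
    cases i <;> simp [actFun, Finset.mul_sum, mul_left_comm]

theorem act_apply (z : G) (x) : M.act z x = M.actFun z x := rfl

theorem act_one : M.act 1 = LinearMap.id := by
  ext1 x
  ext i
  cases i <;> simp [act_apply, actFun, h_one, Q_one]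

theorem act_mul (y z : G) : M.act (y * z) = M.act y ∘ₗ M.act z := by
  refine LinearMap.ext fun x => ?_
  ext i
  cases i <;> simp only [act_apply, actFun, LinearMap.comp_apply, h_mul, Q_mul, mul_inv_rev,
    Finset.mul_sum, Finset.sum_mul]
  all_goals
    rw [Finset.sum_comm]
    exact Finset.sum_congr rfl fun _ _ => Finset.sum_congr rfl fun _ _ => by ring

theorem sum_act_prod_mul_act_dual (z : G) (a b : Fin M.q → K) :
    ∑ s, (∑ t, M.Q s t z * a t) * (∑ u, M.Q u s z⁻¹ * b u) = ∑ s, a s * b s := by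
  have h1 : ∀ u t, ∑ s, M.Q u s z⁻¹ * M.Q s t z = if u = t then 1 else 0 := fun u t => by
    rw [← M.Q_mul, inv_mul_cancel, M.Q_one]
  calc _ = ∑ t, ∑ u, (∑ s, M.Q u s z⁻¹ * M.Q s t z) * (a t * b u) := by
        simp only [Finset.sum_mul_sum]
        simp only [Finset.sum_mul]
        rw [Finset.sum_comm]
        refine Finset.sum_congr rfl fun t _ => ?_
        rw [Finset.sum_comm]
        exact Finset.sum_congr rfl fun _ _ => Finset.sum_congr rfl fun _ _ => by ring
    _ = _ := by simp [h1]

theorem sum_h_τ (z : G) (i l) (a : Fin M.m → K) :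
    ∑ j, M.h l j z * ∑ n, algebraMap k K (M.τ i n j) * a n =
      ∑ n, algebraMap k K (M.τ i n l) * ∑ j, M.h n j z * a j := by
  have h1 := fun n => M.sum_τ_h z i n l
  calc _ = ∑ n, (∑ j, algebraMap k K (M.τ i n j) * M.h l j z) * a n := by
        simp only [Finset.mul_sum, Finset.sum_mul]
        rw [Finset.sum_comm]
        exact Finset.sum_congr rfl fun _ _ => Finset.sum_congr rfl fun _ _ => by ring
    _ = _ := by
        simp only [h1, Finset.mul_sum, Finset.sum_mul]
        rw [Finset.sum_comm]
        exact Finset.sum_congr rfl fun _ _ => Finset.sum_congr rfl fun _ _ => by ring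

theorem sum_Q_c_mul (z : G) (t) (a b : Fin M.m → K) :
    ∑ s, M.Q t s z * ∑ i, ∑ j, algebraMap k K (M.c i j s) * (a i * b j) =
      ∑ i, ∑ j, algebraMap k K (M.c i j t) * ((∑ l, M.h i l z * a l) * ∑ l, M.h j l z * b l) := by
  calc _ = ∑ i, ∑ j, (∑ s, M.Q t s z * algebraMap k K (M.c i j s)) * (a i * b j) := by
        simp only [Finset.mul_sum, Finset.sum_mul]
        rw [Finset.sum_comm]
        refine Finset.sum_congr rfl fun _ _ => ?_
        rw [Finset.sum_comm]
        exact Finset.sum_congr rfl fun _ _ => Finset.sum_congr rfl fun _ _ => by ring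
    _ = ∑ i, ∑ j, ∑ i', ∑ j', algebraMap k K (M.c i' j' t) *
          ((M.h i' i z * a i) * (M.h j' j z * b j)) := by
        simp only [M.sum_Q_c, Finset.sum_mul]
        exact Finset.sum_congr rfl fun _ _ => Finset.sum_congr rfl fun _ _ =>
          Finset.sum_congr rfl fun _ _ => Finset.sum_congr rfl fun _ _ => by ring
    _ = _ := by
        simp only [Finset.sum_mul_sum]
        simp only [Finset.mul_sum]
        rw [Finset.sum_congr rfl fun _ _ => Finset.sum_comm, Finset.sum_comm]
        refine Finset.sum_congr rfl fun _ _ => ?_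
        rw [Finset.sum_congr rfl fun _ _ => Finset.sum_comm, Finset.sum_comm]

theorem act_map_mul (z : G) (x y) :
    M.act z (M.constantsK.mul x y) = M.constantsK.mul (M.act z x) (M.act z y) := by
  ext i
  cases i with
  | unit => 
    simp only [act_apply, actFun, StructureConstants.mul_apply, StructureConstants.mulFun,
      sum_act_prod_mul_act_dual]
  | gen => rfl
  | fix i => rfl
  | fn l =>
    simp only [act_apply, actFun, StructureConstants.mul_apply, StructureConstants.mulFun,
      StructureConstants.map, constants]
    have h1 : ∀ i, ∑ n, algebraMap k K (M.τ i n l) * (∑ j, M.h n j z * x (.fn j)) *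
        y (.fix (Fin.castAdd 3 i)) = ∑ j, M.h l j z * ∑ n, algebraMap k K (M.τ i n j) * x (.fn n) *
        y (.fix (Fin.castAdd 3 i)) := by
      intro i
      rw [← Finset.sum_mul, ← M.sum_h_τ, Finset.sum_mul]
      refine Finset.sum_congr rfl fun _ _ => ?_
      rw [mul_assoc, Finset.sum_mul]
    simp only [h1]
    conv_rhs => rw [← M.sum_h_o z l]
    rw [Finset.sum_comm]
    simp only [Finset.mul_sum, mul_add, Finset.sum_add_distrib]
    congr 1
    congr 1
    · congr 1
      · congr 1
        all_goals exact Finset.sum_congr rfl fun _ _ => by ring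
      · exact Finset.sum_congr rfl fun _ _ => by ring
    · exact Finset.sum_congr rfl fun _ _ => by ring
  | prod s =>
    simp only [act_apply, actFun, StructureConstants.mul_apply, StructureConstants.mulFun,
      StructureConstants.map, constants, ← sum_Q_c_mul]
    simp only [mul_add, Finset.sum_add_distrib]
    simp only [Finset.mul_sum]
    congr 1
    congr 1
    · congr 1
      all_goals exact Finset.sum_congr rfl fun _ _ => by ring
    · exact Finset.sum_congr rfl fun _ _ => by ring
  | dual s =>
    simp only [act_apply, actFun, StructureConstants.mul_apply, StructureConstants.mulFun, mul_add,
      Finset.sum_add_distrib, Finset.mul_sum]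
    congr 1
    · congr 1
      all_goals exact Finset.sum_congr rfl fun _ _ => by ring
    · exact Finset.sum_congr rfl fun _ _ => by ring

end FunctionModel

/-! ### Every automorphism comes from the group. -/

namespace FunctionModel

variable {k : Type u} {K : Type v} [Field k] [Field K] [Algebra k K] {G : Type w} [Group G]
  {𝒢 : LinearAlgebraicKGroup k K G} (M : FunctionModel 𝒢)

open StructureConstants

/-- Left translation by `x` is the combination of the operators `τ i` with coefficients `f i x`; so
commuting with the `τ i` entails commuting with all left translations. -/
theorem sum_mul_f_mul (a : Fin M.m → K) (x y : G) : ∑ j, a j * M.f j (x * y) =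
    ∑ i, M.f i x * ∑ l, (∑ j, algebraMap k K (M.τ i j l) * a j) * M.f l y := by
  simp only [M.f_mul, M.h_eq, Finset.mul_sum, Finset.sum_mul]
  rw [Finset.sum_comm]
  refine Finset.sum_congr rfl fun _ _ => ?_
  rw [Finset.sum_comm]
  exact Finset.sum_congr rfl fun _ _ => Finset.sum_congr rfl fun _ _ => by ring

theorem sum_act_fn_mul_f (a : Fin M.m → K) (x z : G) :
    ∑ l, (∑ j, M.h l j z * a j) * M.f l x = ∑ j, a j * M.f j (x * z) := by
  simp only [M.f_mul, Finset.mul_sum, Finset.sum_mul]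
  rw [Finset.sum_comm]
  exact Finset.sum_congr rfl fun _ _ => Finset.sum_congr rfl fun _ _ => by ring

theorem sum_c_mul_p (a b : Fin M.m → K) (x : G) :
    ∑ s, (∑ i, ∑ j, algebraMap k K (M.c i j s) * (a i * b j)) * M.p s x =
      (∑ i, a i * M.f i x) * ∑ j, b j * M.f j x := by
  rw [Finset.sum_mul_sum]
  simp only [Finset.sum_mul]
  rw [Finset.sum_comm]
  refine Finset.sum_congr rfl fun i _ => ?_
  rw [Finset.sum_comm]
  refine Finset.sum_congr rfl fun j _ => ?_
  have := M.mul_eq i j x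
  calc _ = (∑ s, algebraMap k K (M.c i j s) * M.p s x) * (a i * b j) := by
        rw [Finset.sum_mul]
        exact Finset.sum_congr rfl fun _ _ => by ring
    _ = _ := by rw [← this]; ring

/-- The space spanned by the products of functions, in coordinates, is spanned by the products. -/
theorem span_range_c : Submodule.span K (Set.range fun ij : Fin M.m × Fin M.m =>
    fun s => algebraMap k K (M.c ij.1 ij.2 s)) = ⊤ := by
  let E : (Fin M.q → K) →ₗ[K] (G → K) := Fintype.linearCombination K M.p
  have hE : Function.Injective E := fun a b hab =>
    coeff_eq_of_forall_sum_eq M.p_indep fun x => by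
      simpa [E, Fintype.linearCombination_apply, Finset.sum_apply] using congrFun hab x
  have h1 : ∀ i j, E (fun s => algebraMap k K (M.c i j s)) = M.f i * M.f j := by
    intro i j
    ext x
    rw [Fintype.linearCombination_apply, Finset.sum_apply, Pi.mul_apply, M.mul_eq]
    rfl
  rw [eq_top_iff, ← Pi.basisFun K (Fin M.q) |>.span_eq, Submodule.span_le]
  rintro _ ⟨s, rfl⟩
  have h2 := M.p_span s
  have h3 : (Set.range fun ij : Fin M.m × Fin M.m => M.f ij.1 * M.f ij.2) =
      E '' (Set.range fun ij : Fin M.m × Fin M.m => fun s => algebraMap k K (M.c ij.1 ij.2 s)) := by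
    rw [← Set.range_comp]
    exact congrArg Set.range (funext fun ij => (h1 ij.1 ij.2).symm)
  rw [h3, ← Submodule.map_span] at h2
  obtain ⟨v, hv, hvs⟩ := h2
  have h4 : E (Pi.basisFun K (Fin M.q) s) = M.p s := by
    simp [E, Fintype.linearCombination_apply, Pi.single_apply]
  rw [← h4] at hvs
  rw [← hE hvs]
  exact hv

theorem exists_eq_act {g : (BasisIndex M.m M.q → K) ≃ₗ[K] (BasisIndex M.m M.q → K)}
    (hg : ∀ x y, g (M.constantsK.mul x y) = M.constantsK.mul (g x) (g y)) :
    ∃ z, ∀ x, g x = M.act z x := by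
  let gF : (Fin M.m → K) → Fin M.m → K := fun a l => g (ofFn M.q a) (.fn l)
  let gP : (Fin M.q → K) →ₗ[K] (Fin M.q → K) :=
    { toFun := fun a l => g (ofProd M.m a) (.prod l)
      map_add' := fun a b => by
        have : ofProd M.m (a + b) = ofProd M.m a + ofProd M.m b := by
          ext i; cases i <;> simp [ofProd]
        ext l
        simp [this]
      map_smul' := fun t a => by
        have : ofProd M.m (t • a) = t • ofProd M.m a := by
          ext i; cases i <;> simp [ofProd]
        ext l
        simp [this] }
  let gD : (Fin M.q → K) → Fin M.q → K := fun a l => g (ofDual M.m a) (.dual l)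
  have hF : ∀ a, g (ofFn M.q a) = ofFn M.q (gF a) := map_ofFn hg
  have hP : ∀ a, g (ofProd M.m a) = ofProd M.m (gP a) := map_ofProd hg
  have hD : ∀ a, g (ofDual M.m a) = ofDual M.m (gD a) := map_ofDual hg
  have hone : gF M.constantsK.o = M.constantsK.o := funext fun l =>
    congrFun (map_ofFn_one hg) (.fn l)
  have hτ : ∀ i a, gF (fun l => ∑ j, M.constantsK.τ i j l * a j) =
      fun l => ∑ j, M.constantsK.τ i j l * gF a j := by
    intro i a
    have h := hg (ofFn M.q a) (fixVec K M.q (Fin.castAdd 3 i))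
    rw [ofFn_mul_fixVec, map_fixVec hg, hF, hF, ofFn_mul_fixVec] at h
    exact funext fun l => congrFun h (.fn l)
  have hc : ∀ a b, gP (fun s => ∑ i, ∑ j, M.constantsK.c i j s * (a i * b j)) =
      fun s => ∑ i, ∑ j, M.constantsK.c i j s * (gF a i * gF b j) := by
    intro a b
    have h := hg (ofFn M.q a) (ofFn M.q b)
    rw [ofFn_mul_ofFn, hF, hF, hP, ofFn_mul_ofFn] at h
    exact funext fun l => congrFun h (.prod l)
  have hpair : ∀ a b, ∑ s, gP a s * gD b s = ∑ s, a s * b s := by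
    intro a b
    have h := hg (ofProd M.m a) (ofDual M.m b)
    rw [ofProd_mul_ofDual, hP, hD, ofProd_mul_ofDual, map_smul, map_unitVec hg] at h
    simpa [unitVec] using (congrFun h .unit).symm
  have hsingle : ∀ i j, (fun s => ∑ i', ∑ j', M.constantsK.c i' j' s *
      ((Pi.single i 1 : Fin M.m → K) i' * (Pi.single j 1 : Fin M.m → K) j')) =
      fun s => M.constantsK.c i j s := by
    intro i j
    ext s
    rw [Finset.sum_eq_single i (fun i' _ hi' => by simp [hi']) (by simp),
      Finset.sum_eq_single j (fun j' _ hj' => by simp [hj']) (by simp)]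
    simp
  -- The candidate evaluation: transform the function by `g`, then take its value at the identity.
  let Λ : (Fin M.m → K) →ₗ[K] K :=
    { toFun := fun a => ∑ l, gF a l * M.f l 1
      map_add' := fun a b => by
        have : ofFn M.q (a + b) = ofFn M.q a + ofFn M.q b := by
          ext i; cases i <;> simp [ofFn]
        simp [gF, this, add_mul, Finset.sum_add_distrib]
      map_smul' := fun t a => by
        have : ofFn M.q (t • a) = t • ofFn M.q a := by
          ext i; cases i <;> simp [ofFn]
        simp [gF, this, mul_assoc, Finset.mul_sum] }
  have hΛ : ∀ a, Λ a = ∑ i, a i * Λ (Pi.single i 1) := by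
    intro a
    conv_lhs => rw [pi_eq_sum_univ' a, map_sum]
    refine Finset.sum_congr rfl fun i _ => ?_
    rw [map_smul, smul_eq_mul]
  -- The second family is the analogous form on `F * F`; compatibility of the two forms is `hc`
  -- evaluated at the identity.
  obtain ⟨z, hz⟩ := M.exists_point (fun i => Λ (Pi.single i 1))
    (fun s => ∑ t, gP (Pi.single s 1) t * M.p t 1) (by
      refine Eq.trans ?_ (M.one_eq 1)
      have h := hΛ M.constantsK.o
      have h2 : Λ M.constantsK.o = ∑ i, gF M.constantsK.o i * M.f i 1 := rfl
      rw [h2, hone] at h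
      exact h.symm) (by
      intro i j
      have h := M.sum_c_mul_p (gF (Pi.single i 1)) (gF (Pi.single j 1)) 1
      refine h.symm.trans ?_
      have h2 := hc (Pi.single i 1) (Pi.single j 1)
      rw [hsingle, pi_eq_sum_univ' fun s => M.constantsK.c i j s, map_sum] at h2
      simp only [map_smul] at h2
      calc _ = ∑ t, (fun s => ∑ i', ∑ j', M.constantsK.c i' j' s *
            (gF (Pi.single i 1) i' * gF (Pi.single j 1) j')) t * M.p t 1 := rfl
        _ = _ := by
          rw [← h2]
          simp only [Finset.sum_apply, Pi.smul_apply, smul_eq_mul, Finset.sum_mul, Finset.mul_sum]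
          rw [Finset.sum_comm]
          exact Finset.sum_congr rfl fun _ _ => Finset.sum_congr rfl fun _ _ => mul_assoc _ _ _)
  have hΛz : ∀ a, Λ a = ∑ i, a i * M.f i z := fun a => by simp only [hΛ a, hz]
  have hFz : ∀ a, gF a = fun l => ∑ j, M.h l j z * a j := by
    intro a
    refine coeff_eq_of_forall_sum_eq M.f_indep fun x => ?_
    -- `(g a)(x) = ∑ f_i(x) (τ_i g a)(1) = ∑ f_i(x) Λ(τ_i a) = ∑ f_i(x) (τ_i a)(z) = a(xz)`.
    rw [sum_act_fn_mul_f, ← mul_one x, sum_mul_f_mul, mul_one, sum_mul_f_mul]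
    refine Finset.sum_congr rfl fun i _ => ?_
    rw [← hΛz]
    change _ = M.f i x * ∑ l, gF (fun l => ∑ j, M.constantsK.τ i j l * a j) l * M.f l 1
    rw [hτ]
    rfl
  have hPz : ∀ a, gP a = fun l => ∑ j, M.Q l j z * a j := by
    suffices h : gP = (Matrix.of fun l j => M.Q l j z).mulVecLin from fun a => by
      rw [h]; rfl
    refine LinearMap.ext_on M.span_range_c ?_
    rintro _ ⟨⟨i, j⟩, rfl⟩
    have h := hc (Pi.single i 1) (Pi.single j 1)
    rw [hsingle] at h
    refine h.trans ?_
    have h2 : (fun s => algebraMap k K (M.c i j s)) = _ := (hsingle i j).symm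
    simp only [h2]
    ext t
    simp only [hFz]
    exact (M.sum_Q_c_mul z t (Pi.single i 1) (Pi.single j 1)).symm
  have hDz : ∀ a, gD a = fun l => ∑ j, M.Q j l z⁻¹ * a j := by
    intro a
    ext u
    -- This vector is chosen so that `gP` sends it to the `u`-th basis vector; the invariant pairing
    -- then reads off the `u`-th coordinate of `gD a`.
    have h1 := hpair (fun s => M.Q s u z⁻¹) a
    have h2 : gP (fun s => M.Q s u z⁻¹) = Pi.single u 1 := by
      rw [hPz]
      ext l
      rw [← M.Q_mul, mul_inv_cancel, M.Q_one, Pi.single_apply]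
    rw [h2] at h1
    simpa [Pi.single_apply] using h1
  refine ⟨z, fun x => ?_⟩
  suffices h : g.toLinearMap = M.act z from LinearMap.congr_fun h x
  refine (Pi.basisFun K _).ext fun i => ?_
  rw [Pi.basisFun_apply]
  change g (Pi.single i 1) = M.actFun z (Pi.single i 1)
  cases i with
  | unit =>
    refine (map_unitVec hg).trans ?_
    ext j
    cases j <;> simp [unitVec, actFun]
  | gen =>
    refine (map_genVec hg).trans ?_
    ext j
    cases j <;> simp [genVec, actFun]
  | fix i =>
    refine (map_fixVec hg i).trans ?_
    ext j
    cases j <;> simp [fixVec, actFun, Pi.single_apply]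
  | fn i =>
    have : (Pi.single (.fn i) 1 : BasisIndex M.m M.q → K) = ofFn M.q (Pi.single i 1) := by
      ext j
      cases j <;> simp [ofFn, Pi.single_apply]
    rw [this, hF, hFz]
    ext j
    cases j <;> simp [ofFn, actFun]
  | prod i =>
    have : (Pi.single (.prod i) 1 : BasisIndex M.m M.q → K) = ofProd M.m (Pi.single i 1) := by
      ext j
      cases j <;> simp [ofProd, Pi.single_apply]
    rw [this, hP, hPz]
    ext j
    cases j <;> simp [ofProd, actFun]
  | dual i =>
    have : (Pi.single (.dual i) 1 : BasisIndex M.m M.q → K) = ofDual M.m (Pi.single i 1) := by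
      ext j
      cases j <;> simp [ofDual, Pi.single_apply]
    rw [this, hD, hDz]
    ext j
    cases j <;> simp [ofDual, actFun]

/-! ### The representation as a closed embedding over `k`. -/

/-- The action of an element of the group on the algebra, as a linear automorphism. -/
def actEquiv (z : G) : (BasisIndex M.m M.q → K) ≃ₗ[K] (BasisIndex M.m M.q → K) :=
  LinearEquiv.ofLinearMap (M.act z) (M.act z⁻¹) (by rw [← act_mul, mul_inv_cancel, act_one])
    (by rw [← act_mul, inv_mul_cancel, act_one])

/-- The representation of the group on the algebra. -/
noncomputable def rep : G →* GLK k K (BasisIndex M.m M.q → k) where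
  toFun z := coordEquiv K _ ≪≫ₗ M.actEquiv z ≪≫ₗ (coordEquiv K _).symm
  map_one' := by
    ext1 x
    simp [actEquiv, act_one]
  map_mul' y z := by
    ext1 x
    simp [actEquiv, act_mul]

theorem rep_apply (z : G) (x) :
    M.rep z x = (coordEquiv K _).symm (M.act z (coordEquiv K _ x)) := rfl

theorem range_rep : M.rep.range = autGroup (LinearMap.BilinMap.baseChange K M.constants.mul) := by
  ext g
  constructor
  · rintro ⟨z, rfl⟩
    intro x y
    apply (coordEquiv K _).injective
    simp only [rep_apply, coordEquiv_baseChange_mul, LinearEquiv.apply_symm_apply, act_map_mul]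
  · intro hg
    obtain ⟨z, hz⟩ := M.exists_eq_act (g := (coordEquiv K _).symm ≪≫ₗ g ≪≫ₗ coordEquiv K _) (by
      intro x y
      obtain ⟨x, rfl⟩ := (coordEquiv (k := k) K _).surjective x
      obtain ⟨y, rfl⟩ := (coordEquiv (k := k) K _).surjective y
      rw [← coordEquiv_baseChange_mul]
      simp only [LinearEquiv.trans_apply, LinearEquiv.symm_apply_apply]
      rw [hg x y, coordEquiv_baseChange_mul])
    refine ⟨z, ?_⟩
    ext1 x
    rw [rep_apply, ← hz]
    simp

theorem actFun_mem (v : BasisIndex M.m M.q → k) (i) :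
    (fun z => M.act z (algebraMap k K ∘ v) i) ∈ 𝒢.kFun := by
  have hconst : ∀ c : k, (fun _ : G => algebraMap k K c) ∈ 𝒢.kFun :=
    fun c => 𝒢.kFun.algebraMap_mem c
  have hsum : ∀ {n : ℕ} (φ : Fin n → G → K) (c : Fin n → k), (∀ j, φ j ∈ 𝒢.kFun) →
      (fun z => ∑ j, φ j z * algebraMap k K (c j)) ∈ 𝒢.kFun := by
    intro n φ c hφ
    have : (fun z => ∑ j, φ j z * algebraMap k K (c j)) =
        ∑ j, φ j * fun _ => algebraMap k K (c j) := by
      ext z; simp [Finset.sum_apply]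
    rw [this]
    exact Subalgebra.sum_mem _ fun j _ => Subalgebra.mul_mem _ (hφ j) (hconst _)
  cases i with
  | unit => exact hconst _
  | gen => exact hconst _
  | fix i => exact hconst _
  | fn i => exact hsum _ _ fun j => M.h_mem i j
  | prod i => exact hsum _ _ fun j => M.Q_mem i j
  | dual i => exact hsum _ _ fun j => 𝒢.inv_mem _ (M.Q_mem j i)

theorem comp_rep_mem {f : GLK k K (BasisIndex M.m M.q → k) → K}
    (hf : f ∈ glFun k K (BasisIndex M.m M.q → k)) : f ∘ M.rep ∈ 𝒢.kFun := by
  induction hf using Algebra.adjoin_induction with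
  | mem f hf =>
    rcases hf with ⟨φ, x, rfl⟩ | rfl
    · have : (fun g : GLK k K (BasisIndex M.m M.q → k) => extendForm K φ (g (1 ⊗ₜ[k] x))) ∘ M.rep =
          ∑ i, φ (Pi.single i 1) • fun z => M.act z (algebraMap k K ∘ x) i := by
        ext z
        simp only [Function.comp_apply, rep_apply, coordEquiv_tmul, one_smul,
          extendForm_coordEquiv_symm, Finset.sum_apply, Pi.smul_apply]
        simp only [Algebra.smul_def]
      rw [this]
      exact Subalgebra.sum_mem _ fun i _ => Subalgebra.smul_mem _ (M.actFun_mem x i) _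
    -- The inverse of the determinant at `z` is the determinant at `z⁻¹`, a polynomial in matrix
    -- coefficients composed with inversion, so no division in `k[G]` occurs.
    · have : (fun g : GLK k K (BasisIndex M.m M.q → k) => (LinearMap.det
          (g : (K ⊗[k] (BasisIndex M.m M.q → k)) →ₗ[K] (K ⊗[k] (BasisIndex M.m M.q → k))))⁻¹) ∘
          M.rep = fun z => (LinearMap.toMatrix' (M.act z⁻¹)).det := by
        ext z
        have h1 : ∀ z, LinearMap.det (M.rep z : (K ⊗[k] (BasisIndex M.m M.q → k)) →ₗ[K]
            (K ⊗[k] (BasisIndex M.m M.q → k))) = LinearMap.det (M.act z) := fun z =>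
          LinearMap.det_conj (M.act z) (coordEquiv K _).symm
        rw [Function.comp_apply, h1, LinearMap.det_toMatrix']
        refine inv_eq_of_mul_eq_one_right ?_
        rw [← LinearMap.det_comp, ← act_mul, mul_inv_cancel, act_one, LinearMap.det_id]
      rw [this]
      refine 𝒢.inv_mem (fun z => (LinearMap.toMatrix' (M.act z)).det) ?_
      have : (fun z => (LinearMap.toMatrix' (M.act z)).det) =
          ∑ σ : Equiv.Perm (BasisIndex M.m M.q), Equiv.Perm.sign σ •
            ∏ i, fun z => M.act z (Pi.single i 1) (σ i) := by
        ext z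
        simp [Matrix.det_apply, Finset.sum_apply, Finset.prod_apply, LinearMap.toMatrix'_apply]
      rw [this]
      refine Subalgebra.sum_mem _ fun σ _ => ?_
      rw [Units.smul_def]
      refine Subalgebra.zsmul_mem _ (Subalgebra.prod_mem _ fun i _ => ?_) _
      convert M.actFun_mem (Pi.single i 1) (σ i) using 4
      ext j
      simp [Pi.single_apply, apply_ite (algebraMap k K)]
  | algebraMap c => exact 𝒢.kFun.algebraMap_mem c
  | add f g _ _ h h' => exact 𝒢.kFun.add_mem h h'
  | mul f g _ _ h h' => exact 𝒢.kFun.mul_mem h h'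

/-- The block of functions has matrix coefficients `h j i`, and `f i = ∑ f_j(1) h j i` with `f_j(1)`
in `k`; the `f i` generate `k[G]`. -/
theorem exists_comp_rep_eq {f : G → K} (hf : f ∈ 𝒢.kFun) :
    ∃ g ∈ glFun k K (BasisIndex M.m M.q → k), g ∘ M.rep = f := by
  let ψ : (GLK k K (BasisIndex M.m M.q → k) → K) →ₐ[k] (G → K) :=
    AlgHom.pi fun z => Pi.evalAlgHom k (fun _ => K) (M.rep z)
  suffices h : 𝒢.kFun ≤ (glFun k K (BasisIndex M.m M.q → k)).map ψ from h hf
  rw [← M.generate]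
  refine Algebra.adjoin_le ?_
  rintro _ ⟨i, rfl⟩
  have h1 : ∀ j, M.h j i ∈ (glFun k K (BasisIndex M.m M.q → k)).map ψ := by
    intro j
    refine ⟨_, matrixCoeff_mem_glFun (LinearMap.proj (.fn j)) (Pi.single (.fn i) 1), ?_⟩
    ext z
    change extendForm K _ (M.rep z _) = _
    rw [rep_apply, coordEquiv_tmul, one_smul, extendForm_coordEquiv_symm,
      Finset.sum_eq_single (.fn j) (fun l _ hl => by simp [hl.symm]) (by simp)]
    simp [act_apply, actFun, Pi.single_apply, apply_ite (algebraMap k K)]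
  choose c hc using fun j => 𝒢.one_rational (M.f j) (M.f_mem j)
  have h2 : M.f i = ∑ j, c j • M.h j i := by
    ext x
    have := M.f_mul i 1 x
    rw [one_mul] at this
    simp [this, hc, Finset.sum_apply, Algebra.smul_def]
  rw [h2]
  exact Subalgebra.sum_mem _ fun j _ => Subalgebra.smul_mem _ (h1 j) _

/-- Both conditions express that `o` represents the constant function `1`: it is nonzero, and
multiplication by it is injective on functions. -/
theorem isSimpleAlgebra : IsSimpleAlgebra M.constants.mul := by
  refine isSimpleAlgebra_mul (fun ho => ?_) fun a ha => ?_
  · have h := M.one_eq 1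
    have h2 : ∀ i, M.o i = 0 := congrFun ho
    simp [h2] at h
  · have h : (fun i => algebraMap k K (a i)) = 0 := by
      refine coeff_eq_of_forall_sum_eq M.f_indep fun x => ?_
      have h1 := M.sum_c_mul_p (fun i => algebraMap k K (a i)) (fun i => algebraMap k K (M.o i)) x
      rw [M.one_eq, mul_one] at h1
      rw [← h1]
      simp only [Pi.zero_apply, zero_mul, Finset.sum_const_zero]
      refine Finset.sum_eq_zero fun s _ => ?_
      have h2 := congrArg (algebraMap k K) (ha s)
      simp only [constants, map_sum, map_mul, map_zero] at h2
      rw [h2, zero_mul]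
    ext i
    exact (map_eq_zero (algebraMap k K)).1 (congrFun h i)

end FunctionModel

end GordeevPopov

theorem theorem2 :
    ∃ N : ℕ → ℕ → ℕ,
      ∀ (k : Type u) (K : Type v) [Field k] [Field K] [Algebra k K] [IsAlgClosed K]
        (G : Type w) [Group G] (𝒢 : LinearAlgebraicKGroup k K G),
        (Infinite k ∨ ∃ n d : ℕ, HasRealization 𝒢 n d ∧ N n d ≤ Nat.card k) →
        ∃ (V : Type u) (_ : AddCommGroup V) (_ : Module k V) (_ : FiniteDimensional k V)
          (μ : V →ₗ[k] V →ₗ[k] V) (t : StructureTensor K (K ⊗[k] V)),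
          IsSimpleAlgebra μ ∧
          IsClosedDefinedOver (glFun k K V)
            (autGroup (LinearMap.BilinMap.baseChange K μ) : Set (GLK k K V)) ∧
          KIsomorphic 𝒢.kFun
            (restrictFun (glFun k K V) (autGroup (LinearMap.BilinMap.baseChange K μ))) ∧
          tensorMul K (K ⊗[k] V) t = LinearMap.BilinMap.baseChange K μ ∧
          t ∈ rationalTensors K V ∧
          IsClosedDefinedOver (glFun k K V) (tensorStabilizer t : Set (GLK k K V)) ∧
          KIsomorphic 𝒢.kFun (restrictFun (glFun k K V) (tensorStabilizer t)) := by
  -- The construction works over every field `k`, without assumptions on the number of its elements.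
  refine ⟨0, fun k K _ _ _ _ G _ 𝒢 _ => ?_⟩
  obtain ⟨M⟩ := 𝒢.nonempty_functionModel
  obtain ⟨t, ht, htμ⟩ := exists_rational_structureTensor K M.constants.mul
  obtain ⟨hcl, hiso⟩ := 𝒢.isClosedDefinedOver_and_kIsomorphic M.rep M.range_rep
    (fun g hg => mem_autGroup_baseChange_of_forall _ hg) (fun f hf => M.comp_rep_mem hf)
    (fun f hf => M.exists_comp_rep_eq hf)
  have hst := tensorStabilizer_eq_autGroup t
  rw [htμ] at hst
  refine ⟨_, _, _, inferInstance, M.constants.mul, t, M.isSimpleAlgebra, hcl, hiso, htμ, ht, ?_, ?_⟩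
  · rw [hst]; exact hcl
  · rw [hst]; exact hiso
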